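/- Conventions. For a ring $R$ (associative, with unit), modules are left $R$-modules, right $R$-modules are modules over $R^{\rm op}$, and $\mathsf{mod}(R)$ is the category of finitely generated left $R$-modules. Let $R$ be left Noetherian. For $M\in\mathsf{mod}(R)$ choose an exact sequence $P_1\xrightarrow{f}P_0\to M\to 0$ with $P_0,P_1$ finitely generated projective. The transpose $\operatorname{Tr}_R(M)$ is the right $R$-module $\operatorname{Coker}\big(\operatorname{Hom}_R(f,R)\colon \operatorname{Hom}_R(P_0,R)\to\operatorname{Hom}_R(P_1,R)\big)$; it is independent of the choice up to projective summands. For $k>0$, $M$ is $k$-torsionfree if $\operatorname{Ext}^i_{R^{\rm op}}(\operatorname{Tr}_R(M),R)=0$ for all $1\le i\le k$, and $\mathsf{TF}^k(R)$ denotes the full subcategory of $\mathsf{mod}(R)$ of $k$-torsionfree modules. An acyclic complex $\mathbf P=(\cdots\to P_1\to P_0\xrightarrow{\partial_0}P_{-1}\to\cdots)$ of projective $R$-modules is totally acyclic if $\operatorname{Hom}_R(\mathbf P,Q)$ is acyclic for every projective $R$-module $Q$. A module is Gorenstein projective if it is isomorphic to the image of $\partial_0$ for some totally acyclic $\mathbf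 P$, and $\mathsf{Gproj}(R)$ is the full subcategory of $\mathsf{mod}(R)$ of Gorenstein projective modules. A full subcategory $\mathcal X$ of $\mathsf{mod}(R)$ has finite representation type if it contains only finitely many isomorphism classes of indecomposable modules. The ring $R$ is CM-finite if $\mathsf{Gproj}(R)$ has finite representation type. For a group $G$ acting on a ring $\Lambda$ by ring automorphisms, the skew group ring $\Lambda G$ is the free left $\Lambda$-module with basis $G$ and multiplication $(\lambda g)(\mu h)=\lambda\, g(\mu)\, gh$ for $\lambda,\mu\in\Lambda$ and $g,h\in G$. Corollary. Let $\Lambda$ be a left Artinian ring and let $G$ be a finite group acting on $\Lambda$ by ring automorphisms. Assume that $|G|$ is invertible in $\Lambda$. Then: 1. For each integer $k>0$, $\mathsf{TF}^k(\Lambda G)$ has finite representation type if and only if $\mathsf{TF}^k(\Lambda)$ has finite representation type. 2. The skew group ring $\Lambda G$ is CM-finite if and only if $\Lambda$ is CM-finite. -/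

import Mathlib

open CategoryTheory

universe u v

/-- The transpose attached to a map `f : P₁ → P₀` of left `R`-modules: the cokernel of
`Hom_R(f, R) : Hom_R(P₀, R) → Hom_R(P₁, R)`, a right `R`-module (that is, an `Rᵐᵒᵖ`-module). -/
abbrev TransposeOf (R : Type u) [Ring R] {P₁ P₀ : Type u} [AddCommGroup P₁] [Module R P₁]
    [AddCommGroup P₀] [Module R P₀] (f : P₁ →ₗ[R] P₀) : Type u :=
  (P₁ →ₗ[R] R) ⧸ LinearMap.range (LinearMap.lcomp Rᵐᵒᵖ R f)

/-- A presentation `P₁ → P₀ → M → 0` of a left `R`-module `M` by finitely generated projective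
left `R`-modules. -/
structure ProjPresentation (R : Type u) [Ring R] (M : ModuleCat.{u} R) where
  P₁ : ModuleCat.{u} R
  P₀ : ModuleCat.{u} R
  finite₁ : Module.Finite R P₁
  finite₀ : Module.Finite R P₀
  projective₁ : Module.Projective R P₁
  projective₀ : Module.Projective R P₀
  f : P₁ →ₗ[R] P₀
  π : P₀ →ₗ[R] M
  exact : Function.Exact f π
  surjective : Function.Surjective π

/-- The transpose of `M` with respect to a given presentation, as a right `R`-module. -/
noncomputable def ProjPresentation.transpose {R : Type u} [Ring R] {M : ModuleCat.{u} R}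
    (ε : ProjPresentation R M) : ModuleCat.{u} Rᵐᵒᵖ :=
  ModuleCat.of Rᵐᵒᵖ (TransposeOf R ε.f)

/-- `TF R k` is the full subcategory of `k`-torsionfree modules in `mod(R)`, for a left Noetherian
ring `R`: the finitely generated left `R`-modules `M` with `Ext^i(Tr M, R) = 0` (over right
`R`-modules) for `1 ≤ i ≤ k`. The transpose is unique up to projective summands, so the
vanishing does not depend on the presentation. -/
def TF (R : Type u) [Ring R] (k : ℕ) : ObjectProperty (ModuleCat.{u} R) := fun M =>
  Module.Finite R M ∧ ∃ ε : ProjPresentation R M, ∀ i : ℕ, 1 ≤ i → i ≤ k →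
    Subsingleton (Abelian.Ext ε.transpose (ModuleCat.of Rᵐᵒᵖ R) i)

/-- A totally acyclic complex of left `R`-modules: an acyclic complex
`⋯ → P₁ → P₀ → P₋₁ → ⋯` of projectives (indexed by `ℤ`, not necessarily finitely generated) such
that `Hom_R(P, Q)` is acyclic for every projective `Q`. -/
structure IsTotallyAcyclic {R : Type u} [Ring R] (P : ChainComplex (ModuleCat.{u} R) ℤ) :
    Prop where
  projective : ∀ i, Module.Projective R (P.X i)
  acyclic : P.Acyclic
  hom_acyclic : ∀ Q : ModuleCat.{u} R, Module.Projective R Q →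
    ∀ (i : ℤ) (φ : P.X i ⟶ Q), P.d (i + 1) i ≫ φ = 0 →
      ∃ ψ : P.X (i - 1) ⟶ Q, P.d i (i - 1) ≫ ψ = φ

/-- `Gproj R` is the full subcategory of Gorenstein projective modules in `mod(R)`. -/
def Gproj (R : Type u) [Ring R] : ObjectProperty (ModuleCat.{u} R) := fun M =>
  Module.Finite R M ∧ ∃ P : ChainComplex (ModuleCat.{u} R) ℤ, IsTotallyAcyclic P ∧
    Nonempty (M ≃ₗ[R] LinearMap.range (P.d 0 (-1)).hom)

/-- A full subcategory of modules has finite representation type if it contains only finitely many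
isomorphism classes of indecomposable modules. -/
def HasFiniteRepType {R : Type u} [Ring R] (𝒳 : ObjectProperty (ModuleCat.{u} R)) : Prop :=
  {c : Quotient (isIsomorphicSetoid (ModuleCat.{u} R)) |
    ∃ M : ModuleCat.{u} R, 𝒳 M ∧ Indecomposable M ∧ Quotient.mk _ M = c}.Finite

/-- `R` is CM-finite if `Gproj R` has finite representation type. -/
def IsCMFinite (R : Type u) [Ring R] : Prop :=
  HasFiniteRepType (Gproj R)

/-! The inclusion of `Λ` into `ΛG` is a Frobenius extension: the coefficient at `1` is a bimodule
trace with dual bases `g⁻¹`, `g`. For a Frobenius extension `R → S`, coextension `Hom_R(S, -)` is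
both right and left adjoint to restriction. Hence both functors are exact, preserve projectives and
finite generation, and allow Ext-vanishing to be moved across the adjunctions
(`ExtVanishes.of_adjunction`).

Both functors also commute with duals (`dualRestrictIso`, `dualCoextendIso`), hence with transposes.
Over the opposite rings, the Ext groups that define torsionfreeness are thus controlled by Ext from
the original transpose into `Hom(S, R)`, a summand of `S`, or into `S`, a summand of a finite power
of `R` (`TF_restrict`, `TF_coextend`). Gorenstein projectivity is recast coinductively, through
embeddings into projectives with cokernel of the same kind (`gproj_iff`), a form that such functors
visibly preserve (`IsGorenstein.map`).

The trace of `1` is `1`, so every `Λ`-module is a summand of the restriction of its coextension; `∑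
g⁻¹ g = |G|` is invertible, so every `ΛG`-module is a summand of the coextension of its restriction.
Over Artinian rings indecomposables of finite length have local endomorphism rings. An
indecomposable in one class is therefore a summand of the image of an indecomposable in the other,
and each image has finitely many indecomposable summands (`HasFiniteRepType.of_functors`). -/

/-! ### Vanishing of Ext in a range of degrees -/

section ExtVanishing

open Abelian Limits

universe w v₁ v₂ u₁ u₂

variable {C : Type u₁} [Category.{v₁} C] [Abelian C]

lemma exists_shortExact_projective [EnoughProjectives C] (T : C) :
    ∃ S : ShortComplex C, S.ShortExact ∧ Projective S.X₂ ∧ S.X₃ = T :=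
  ⟨ShortComplex.mk (kernel.ι (Projective.π T)) (Projective.π T) (by simp),
    { exact := ShortComplex.exact_kernel _ }, inferInstance, rfl⟩

variable [HasExt.{w} C]

/-- `Ext^i(T, X) = 0` for all `1 ≤ i ≤ k`. -/
def ExtVanishes (T X : C) (k : ℕ) : Prop :=
  ∀ i : ℕ, 1 ≤ i → i ≤ k → Subsingleton (Ext T X i)

lemma extVanishes_zero (T X : C) : ExtVanishes T X 0 := fun i h₁ h₂ => by omega

/-- Dimension shifting. -/
lemma extVanishes_succ_iff {S : ShortComplex C} (hS : S.ShortExact) [Projective S.X₂] (X : C)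
    (k : ℕ) : ExtVanishes S.X₃ X (k + 1) ↔
      (∀ g : S.X₁ ⟶ X, ∃ h : S.X₂ ⟶ X, S.f ≫ h = g) ∧ ExtVanishes S.X₁ X k := by
  constructor
  · intro h
    refine ⟨fun g => ?_, fun i h₁ h₂ => ⟨fun a b => ?_⟩⟩
    · have := h 1 le_rfl (by omega)
      obtain ⟨x, hx⟩ := Ext.contravariant_sequence_exact₁ hS X (Ext.mk₀ g) (add_zero 1)
        (Subsingleton.elim _ _)
      obtain ⟨x, rfl⟩ := Ext.mk₀_bijective _ _ |>.2 x
      rw [Ext.mk₀_comp_mk₀] at hx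
      exact ⟨x, Ext.mk₀_bijective _ _ |>.1 hx⟩
    · have := h (i + 1) (by omega) (by omega)
      rw [← sub_eq_zero]
      obtain ⟨x, hx⟩ := Ext.contravariant_sequence_exact₁ hS X (a - b) (add_comm 1 i)
        (Subsingleton.elim _ _)
      obtain ⟨j, rfl⟩ := Nat.exists_eq_add_of_le' h₁
      rw [← hx, Ext.eq_zero_of_projective x, Ext.comp_zero]
  · rintro ⟨hsurj, h⟩ i h₁ h₂
    obtain ⟨j, rfl⟩ := Nat.exists_eq_add_of_le' h₁
    refine subsingleton_of_forall_eq 0 fun a => ?_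
    obtain ⟨x, rfl⟩ := Ext.contravariant_sequence_exact₃ hS X a
      (Ext.eq_zero_of_projective _) (add_comm 1 j)
    -- In degree one the class is the extension class composed with a map `g` that extends over
    -- `S.X₂`, so it is zero; in higher degrees the factor itself vanishes.
    rcases Nat.eq_zero_or_pos j with rfl | hj
    · obtain ⟨g, rfl⟩ := Ext.mk₀_bijective _ _ |>.2 x
      obtain ⟨h', rfl⟩ := hsurj g
      rw [← Ext.mk₀_comp_mk₀, ShortComplex.ShortExact.extClass_comp_assoc]
    · have := h j hj (by omega)
      rw [Subsingleton.elim x 0, Ext.comp_zero]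

variable {D : Type u₂} [Category.{v₂} D] [Abelian D] [HasExt.{w} D]

/-- An exact left adjoint whose right adjoint is exact shifts vanishing of `Ext` along the
adjunction. -/
lemma ExtVanishes.of_adjunction [EnoughProjectives C] {L : C ⥤ D} {H : D ⥤ C} (adj : L ⊣ H)
    [L.PreservesZeroMorphisms] [PreservesFiniteLimits L] [PreservesFiniteColimits L]
    [L.PreservesProjectiveObjects] {X : D} {k : ℕ} {T : C} (h : ExtVanishes T (H.obj X) k) :
    ExtVanishes (L.obj T) X k := by
  induction k generalizing T with
  | zero => exact extVanishes_zero _ _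
  | succ k ih =>
    -- No Ext isomorphism is needed: `L` carries a projective presentation of `T` to one of `L T`,
    -- and the adjunction transports the extension problem in degree one.
    obtain ⟨S, hS, hP, rfl⟩ := exists_shortExact_projective T
    obtain ⟨h₁, h₂⟩ := (extVanishes_succ_iff hS _ _).1 h
    have hLS : (S.map L).ShortExact := hS.map_of_exact L
    have : Projective (S.map L).X₂ := L.projective_obj_of_projective hP
    refine (extVanishes_succ_iff hLS _ _).2 ⟨fun g => ?_, ih h₂⟩
    obtain ⟨t, ht⟩ := h₁ (adj.homEquiv _ _ g)
    exact ⟨(adj.homEquiv _ _).symm t,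
      (adj.homEquiv_naturality_left_symm S.f t).symm.trans ((Equiv.symm_apply_eq _).2 ht)⟩

/-- If the identity of `Y` is a sum of endomorphisms factoring through `X`, then vanishing of
`Ext(T, X)` gives vanishing of `Ext(T, Y)`. -/
lemma ExtVanishes.of_sum_factor {T X Y : C} {k : ℕ} (h : ExtVanishes T X k) {ι : Type*}
    [Fintype ι] (a : ι → (Y ⟶ X)) (b : ι → (X ⟶ Y)) (hab : ∑ i, a i ≫ b i = 𝟙 Y) :
    ExtVanishes T Y k := by
  intro i h₁ h₂
  have := h i h₁ h₂
  refine subsingleton_of_forall_eq 0 fun e => ?_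
  rw [← Ext.comp_mk₀_id e, ← hab, Ext.mk₀_sum, Ext.comp_sum]
  refine Finset.sum_eq_zero fun j _ => ?_
  rw [← Ext.mk₀_comp_mk₀, ← Ext.comp_assoc (a₁₂ := i) (a₂₃ := 0) (a := i) e _ _ (by simp)
      (by simp) (by simp),
    Subsingleton.elim (e.comp (Ext.mk₀ (a j)) (add_zero i)) 0, Ext.zero_comp]

/-- If the identity of `T'` factors through `T` up to a map factoring through a projective, then
vanishing of `Ext(T, X)` gives vanishing of `Ext(T', X)`. -/
lemma ExtVanishes.of_stable_retract {T T' P X : C} [Projective P] {k : ℕ}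
    (h : ExtVanishes T X k) (a : T' ⟶ T) (b : T ⟶ T') (c : T' ⟶ P) (d : P ⟶ T')
    (habcd : a ≫ b + c ≫ d = 𝟙 T') : ExtVanishes T' X k := by
  intro i h₁ h₂
  have := h i h₁ h₂
  obtain ⟨j, rfl⟩ := Nat.exists_eq_add_of_le' h₁
  refine subsingleton_of_forall_eq 0 fun e => ?_
  rw [← Ext.mk₀_id_comp e, ← habcd, Ext.mk₀_add, Ext.add_comp, ← Ext.mk₀_comp_mk₀,
    ← Ext.mk₀_comp_mk₀, Ext.comp_assoc_of_second_deg_zero, Ext.comp_assoc_of_second_deg_zero,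
    Subsingleton.elim ((Ext.mk₀ b).comp e (zero_add _)) 0, Ext.comp_zero,
    Ext.eq_zero_of_projective ((Ext.mk₀ d).comp e (zero_add _)), Ext.comp_zero, add_zero]

end ExtVanishing

/-! ### Transposes: independence of the presentation and retracts -/

section Transpose

open LinearMap

/-- A ring as a right module over itself is its opposite ring as a left module over itself. -/
def rightRegularEquiv (R : Type u) [Ring R] : R ≃ₗ[Rᵐᵒᵖ] Rᵐᵒᵖ :=
  { MulOpposite.opAddEquiv with map_smul' := fun _ _ => rfl }

/-- The dual of a finitely generated projective left module is a projective right module. -/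
lemma projective_dual (R : Type u) [Ring R] (P : Type*) [AddCommGroup P] [Module R P]
    [Module.Finite R P] [Module.Projective R P] : Module.Projective Rᵐᵒᵖ (P →ₗ[R] R) := by
  obtain ⟨n, q, s, -, -, hqs⟩ := Module.Finite.exists_comp_eq_id_of_projective R P
  let i : (P →ₗ[R] R) →ₗ[Rᵐᵒᵖ] (Fin n → R) :=
    { toFun := fun α j => α (q (Pi.single j 1))
      map_add' := fun _ _ => rfl
      map_smul' := fun _ _ => rfl }
  let t : (Fin n → R) →ₗ[Rᵐᵒᵖ] (P →ₗ[R] R) :=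
    { toFun := fun v => ∑ j, (LinearMap.proj j ∘ₗ s).smulRight (v j)
      map_add' := fun v w => by ext; simp [mul_add, Finset.sum_add_distrib]
      map_smul' := fun r v => by ext; simp [Finset.sum_mul, mul_assoc] }
  have : Module.Projective Rᵐᵒᵖ (Fin n → R) :=
    Module.Projective.of_equiv (LinearEquiv.piCongrRight fun _ => (rightRegularEquiv R).symm)
  refine Module.Projective.of_split i t (LinearMap.ext fun α => LinearMap.ext fun p => ?_)
  have h : p = ∑ j, s p j • q (Pi.single j 1) := by
    conv_lhs => rw [← LinearMap.id_apply (R := R) p, ← hqs, LinearMap.comp_apply,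
      ← Finset.univ_sum_single (s p), map_sum]
    refine Finset.sum_congr rfl fun j _ => ?_
    rw [← map_smul, ← Pi.single_smul, smul_eq_mul, mul_one]
  conv_rhs => rw [LinearMap.id_apply, h, map_sum]
  simp [i, t]

/-- Finitely generated modules over left Noetherian rings admit presentations. -/
lemma exists_projPresentation {R : Type u} [Ring R] [IsNoetherianRing R] (M : ModuleCat.{u} R)
    [Module.Finite R M] : Nonempty (ProjPresentation R M) := by
  obtain ⟨n, π, hπ⟩ := Module.Finite.exists_fin' R M
  obtain ⟨m, f, hf⟩ := (Submodule.fg_iff_exists_fin_linearMap _ _).1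
    (IsNoetherian.noetherian (LinearMap.ker π))
  exact ⟨{
    P₁ := ModuleCat.of R (Fin m → R)
    P₀ := ModuleCat.of R (Fin n → R)
    finite₁ := inferInstanceAs (Module.Finite R (Fin m → R))
    finite₀ := inferInstanceAs (Module.Finite R (Fin n → R))
    projective₁ := inferInstanceAs (Module.Projective R (Fin m → R))
    projective₀ := inferInstanceAs (Module.Projective R (Fin n → R))
    f := f
    π := π
    exact := LinearMap.exact_iff.2 hf.symm
    surjective := hπ }⟩

lemma LinearMap.exists_lift_of_exact {R : Type*} [Ring R] {P A B C : Type*} [AddCommGroup P]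
    [Module R P] [Module.Projective R P] [AddCommGroup A] [Module R A] [AddCommGroup B]
    [Module R B] [AddCommGroup C] [Module R C] {f : A →ₗ[R] B} {g : B →ₗ[R] C}
    (h : Function.Exact f g) (x : P →ₗ[R] B) (hx : g ∘ₗ x = 0) : ∃ y : P →ₗ[R] A, f ∘ₗ y = x := by
  have hr : ∀ p, x p ∈ LinearMap.range f := fun p =>
    (h (x p)).1 (LinearMap.congr_fun hx p)
  obtain ⟨y, hy⟩ := Module.projective_lifting_property f.rangeRestrict (x.codRestrict _ hr)
    f.surjective_rangeRestrict
  exact ⟨y, LinearMap.ext fun p => congrArg Subtype.val (LinearMap.congr_fun hy p)⟩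

/-- Vanishing of the `Ext` groups of the transpose passes to retracts, for arbitrary choices of
presentations. -/
lemma ProjPresentation.extVanishes_of_retract {R : Type u} [Ring R] {M M' : ModuleCat.{u} R}
    (ε : ProjPresentation R M) (ε' : ProjPresentation R M') (i : M →ₗ[R] M') (p : M' →ₗ[R] M)
    (hpi : p ∘ₗ i = LinearMap.id) {X : ModuleCat.{u} Rᵐᵒᵖ} {k : ℕ}
    (h : ExtVanishes ε'.transpose X k) : ExtVanishes ε.transpose X k := by
  have := ε.projective₀
  have := ε.projective₁
  have := ε.finite₁
  have := ε'.projective₀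
  have := ε'.projective₁
  obtain ⟨a₀, ha₀⟩ := Module.projective_lifting_property ε'.π (i ∘ₗ ε.π) ε'.surjective
  obtain ⟨a₁, ha₁⟩ := LinearMap.exists_lift_of_exact ε'.exact (a₀ ∘ₗ ε.f) (by
    rw [← LinearMap.comp_assoc, ha₀, LinearMap.comp_assoc, ε.exact.linearMap_comp_eq_zero,
      LinearMap.comp_zero])
  obtain ⟨b₀, hb₀⟩ := Module.projective_lifting_property ε.π (p ∘ₗ ε'.π) ε.surjective
  obtain ⟨b₁, hb₁⟩ := LinearMap.exists_lift_of_exact ε.exact (b₀ ∘ₗ ε'.f) (by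
    rw [← LinearMap.comp_assoc, hb₀, LinearMap.comp_assoc, ε'.exact.linearMap_comp_eq_zero,
      LinearMap.comp_zero])
  -- Since `p i = 1`, the lift `b₀ a₀` is homotopic to the identity. With the homotopy `s`, the map
  -- `u = 1 - b₁ a₁ - s f` satisfies `f u = 0`, so precomposition with `u` descends from the
  -- transpose to the projective dual of `P₁`.
  obtain ⟨s, hs⟩ := LinearMap.exists_lift_of_exact ε.exact (LinearMap.id - b₀ ∘ₗ a₀) (by
    rw [LinearMap.comp_sub, ← LinearMap.comp_assoc, hb₀, LinearMap.comp_assoc, ha₀,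
      ← LinearMap.comp_assoc, hpi, LinearMap.id_comp, LinearMap.comp_id, sub_self])
  have hfu : ∀ x, ε.f (x - b₁ (a₁ x) - s (ε.f x)) = 0 := fun x => by
    have h₁ := LinearMap.congr_fun hb₁ (a₁ x)
    have h₂ := LinearMap.congr_fun ha₁ x
    have h₃ := LinearMap.congr_fun hs (ε.f x)
    simp only [LinearMap.comp_apply, LinearMap.sub_apply, LinearMap.id_apply] at h₁ h₂ h₃
    rw [map_sub, map_sub, h₁, h₂, h₃]
    abel
  let D := LinearMap.lcomp Rᵐᵒᵖ R ε.f
  let D' := LinearMap.lcomp Rᵐᵒᵖ R ε'.f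
  have hA : LinearMap.range D ≤ (LinearMap.range D').comap (LinearMap.lcomp Rᵐᵒᵖ R b₁) := by
    rintro _ ⟨β, rfl⟩
    refine ⟨β ∘ₗ b₀, LinearMap.ext fun x => ?_⟩
    exact congrArg β (LinearMap.congr_fun hb₁ x).symm
  have hB : LinearMap.range D' ≤ (LinearMap.range D).comap (LinearMap.lcomp Rᵐᵒᵖ R a₁) := by
    rintro _ ⟨β, rfl⟩
    refine ⟨β ∘ₗ a₀, LinearMap.ext fun x => ?_⟩
    exact congrArg β (LinearMap.congr_fun ha₁ x).symm
  have hC : LinearMap.range D ≤ LinearMap.ker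
      (LinearMap.lcomp Rᵐᵒᵖ R (LinearMap.id - b₁ ∘ₗ a₁ - s ∘ₗ ε.f)) := by
    rintro _ ⟨β, rfl⟩
    exact LinearMap.ext fun x => (congrArg β (hfu x)).trans (map_zero β)
  have hP : Projective (ModuleCat.of Rᵐᵒᵖ (ε.P₁ →ₗ[R] R)) :=
    (IsProjective.iff_projective _).1 (projective_dual R ε.P₁)
  refine h.of_stable_retract (P := ModuleCat.of Rᵐᵒᵖ (ε.P₁ →ₗ[R] R))
    (ModuleCat.ofHom (Submodule.mapQ _ _ _ hA)) (ModuleCat.ofHom (Submodule.mapQ _ _ _ hB))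
    (ModuleCat.ofHom (Submodule.liftQ _ _ hC)) (ModuleCat.ofHom (Submodule.mkQ _))
    (ModuleCat.hom_ext (Submodule.linearMap_qext _ (LinearMap.ext fun α => ?_)))
  refine (Submodule.Quotient.eq _).2 ?_
  -- The two composites add up to the identity up to `α s f`, which lies in the image of the dual of
  -- `f`.
  refine ⟨-(α ∘ₗ s), LinearMap.ext fun x => ?_⟩
  change -(α (s (ε.f x))) = α (b₁ (a₁ x)) + α (x - b₁ (a₁ x) - s (ε.f x)) - α x
  rw [map_sub, map_sub]
  abel

lemma TF.of_retract {R : Type u} [Ring R] [IsNoetherianRing R] {k : ℕ} {M M' : ModuleCat.{u} R}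
    (h : TF R k M') (r : Retract M M') : TF R k M := by
  obtain ⟨hM', ε', hε'⟩ := h
  have hr : r.r.hom ∘ₗ r.i.hom = LinearMap.id := by rw [← ModuleCat.hom_comp, r.retract]; rfl
  have hfin : Module.Finite R M := Module.Finite.of_surjective r.r.hom
    (fun x => ⟨r.i.hom x, LinearMap.congr_fun hr x⟩)
  obtain ⟨ε⟩ := exists_projPresentation M
  exact ⟨hfin, ε, ε.extVanishes_of_retract ε' r.i.hom r.r.hom hr hε'⟩

end Transpose

/-! ### Frobenius extensions and the two adjunctions -/

noncomputable section Frobenius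

open ModuleCat

universe u₁ u₂ w

/-- A Frobenius system for a ring extension `φ : R → S`: an `R`-bimodule map `S → R` with a pair
of dual bases. -/
structure FrobeniusSystem {R : Type u₁} {S : Type u₂} [Ring R] [Ring S] (φ : R →+* S)
    (ι : Type w) [Fintype ι] where
  trace : S →+ R
  trace_left : ∀ r s, trace (φ r * s) = r * trace s
  trace_right : ∀ s r, trace (s * φ r) = trace s * r
  x : ι → S
  y : ι → S
  sum_left : ∀ s, ∑ i, φ (trace (s * x i)) * y i = s
  sum_right : ∀ s, ∑ i, x i * φ (trace (y i * s)) = s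

namespace FrobeniusSystem

variable {ι : Type w} [Fintype ι]

/-- The notion of a Frobenius system is left-right symmetric. -/
def op {R : Type u₁} {S : Type u₂} [Ring R] [Ring S] {φ : R →+* S} (E : FrobeniusSystem φ ι) :
    FrobeniusSystem (RingHom.op φ) ι where
  trace :=
    { toFun := fun s => MulOpposite.op (E.trace s.unop)
      map_zero' := congrArg MulOpposite.op E.trace.map_zero
      map_add' := fun s t => congrArg MulOpposite.op (E.trace.map_add s.unop t.unop) }
  trace_left r s := congrArg MulOpposite.op (E.trace_right s.unop r.unop)
  trace_right s r := congrArg MulOpposite.op (E.trace_left r.unop s.unop)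
  x i := MulOpposite.op (E.y i)
  y i := MulOpposite.op (E.x i)
  sum_left s := MulOpposite.unop_injective (by
    rw [Finset.unop_sum]; exact E.sum_right s.unop)
  sum_right s := MulOpposite.unop_injective (by
    rw [Finset.unop_sum]; exact E.sum_left s.unop)

variable {R S : Type u} [Ring R] [Ring S] {φ : R →+* S} (E : FrobeniusSystem φ ι)

/-- The unit `M → Hom_R(S, M)` of the adjunction between coextension and restriction. -/
def unitMap (M : ModuleCat.{u} R) :
    M ⟶ (restrictScalars φ).obj ((coextendScalars φ).obj M) :=
  ofHom (Y := (restrictScalars φ).obj ((coextendScalars φ).obj M))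
    { toFun := fun m => (CoextendScalars.equiv φ M).symm
        { toFun := fun s : S => E.trace s • m
          map_add' := fun s t => by rw [← add_smul]; exact congrArg (· • m) (E.trace.map_add s t)
          map_smul' := fun r s => (congrArg (· • m) (E.trace_left r s)).trans (mul_smul _ _ _) }
      map_add' := fun m n => CoextendScalars.ext (LinearMap.ext fun s : S => smul_add _ _ _)
      map_smul' := fun r m => CoextendScalars.ext (LinearMap.ext fun s : S => by
        change E.trace s • r • m = E.trace (s * φ r) • m
        rw [E.trace_right, mul_smul]) }

/-- Apply the `R`-linear map `f` to the dual basis expansion of `t`; in particular `f` is determined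
by its values on the `y j`. -/
lemma coextend_apply_eq (M : ModuleCat.{u} R) (f : (coextendScalars φ).obj M) (t : S) :
    f t = ∑ j, E.trace (t * E.x j) • f (E.y j) := by
  conv_lhs => rw [← E.sum_left t]
  refine (map_sum (CoextendScalars.equiv φ M f) _ _).trans (Finset.sum_congr rfl fun j _ => ?_)
  exact (CoextendScalars.equiv φ M f).map_smul (E.trace (t * E.x j)) (E.y j)

/-- The counit `Hom_R(S, N) → N` of the adjunction between coextension and restriction. -/
def counitMap (N : ModuleCat.{u} S) :
    (coextendScalars φ).obj ((restrictScalars φ).obj N) ⟶ N :=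
  ofHom (X := (coextendScalars φ).obj ((restrictScalars φ).obj N))
    { toFun := fun f => ∑ i, E.x i • (show N from f (E.y i))
      map_add' := fun f g => by
        rw [← Finset.sum_add_distrib]
        exact Finset.sum_congr rfl fun i _ => smul_add (A := N) _ _ _
      map_smul' := fun s f => by
        -- `S`-linearity of the counit: expand `y i * s` in the basis `y j`, then sum over `i`
        -- first, where the other dual basis identity collapses the coefficients to `s * x j`.
        have h : ∀ i, (show N from f (E.y i * s)) =
            ∑ j, φ (E.trace (E.y i * (s * E.x j))) • (show N from f (E.y j)) := fun i => by
          refine (E.coextend_apply_eq _ f (E.y i * s)).trans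
            (Finset.sum_congr rfl fun j _ => ?_)
          rw [mul_assoc]
          rfl
        calc ∑ i, E.x i • (show N from f (E.y i * s))
            = ∑ j, ∑ i, (E.x i * φ (E.trace (E.y i * (s * E.x j)))) •
                (show N from f (E.y j)) := by
              rw [Finset.sum_comm]
              refine Finset.sum_congr rfl fun i _ => ?_
              rw [h, Finset.smul_sum]
              exact Finset.sum_congr rfl fun j _ => (mul_smul _ _ _).symm
          _ = s • ∑ j, E.x j • (show N from f (E.y j)) := by
              rw [Finset.smul_sum]
              refine Finset.sum_congr rfl fun j _ => ?_
              rw [← Finset.sum_smul, E.sum_right, mul_smul] }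

/-- For a Frobenius extension, coextension of scalars is also left adjoint to restriction. -/
def coextendRestrictAdj : coextendScalars.{u, u, u} φ ⊣ restrictScalars.{u} φ :=
  Adjunction.mkOfUnitCounit
    { unit :=
        { app := E.unitMap
          naturality := fun M M' g => ModuleCat.hom_ext (LinearMap.ext fun m =>
            CoextendScalars.ext (LinearMap.ext fun s : S => (g.hom.map_smul _ _).symm)) }
      counit :=
        { app := E.counitMap
          naturality := fun N N' g => ModuleCat.hom_ext (LinearMap.ext fun
              (f : (coextendScalars φ).obj ((restrictScalars φ).obj N)) => by
            change ∑ i, E.x i • g.hom (show N from f (E.y i)) =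
              g.hom (∑ i, E.x i • (show N from f (E.y i)))
            rw [map_sum]
            exact Finset.sum_congr rfl fun i _ => (g.hom.map_smul _ _).symm) }
      left_triangle := by
        ext M f
        refine CoextendScalars.ext (LinearMap.ext fun t : S => ?_)
        let f : (coextendScalars φ).obj M := f
        change CoextendScalars.equiv φ M (∑ i, E.x i •
          (show (coextendScalars φ).obj M from (E.unitMap M).hom (f (E.y i)))) t = f t
        rw [E.coextend_apply_eq M f t, map_sum]
        exact LinearMap.sum_apply (M := (restrictScalars φ).obj (of S S)) _ _ t
      right_triangle := by
        ext N n
        change ∑ i, E.x i • φ (E.trace (E.y i)) • (show N from n) = (show N from n)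
        have h := E.sum_right 1
        simp only [mul_one] at h
        conv_rhs => rw [← one_smul S (show N from n), ← h, Finset.sum_smul]
        exact Finset.sum_congr rfl fun i _ => (mul_smul _ _ _).symm }

/-- If the trace of `1` is `1`, every module is a retract of the restriction of its
coextension. -/
def retractRestrictCoextend (h : E.trace 1 = 1) (M : ModuleCat.{u} R) :
    Retract M ((restrictScalars φ).obj ((coextendScalars φ).obj M)) where
  i := E.unitMap M
  r := (restrictCoextendScalarsAdj φ).counit.app M
  retract := ModuleCat.hom_ext (LinearMap.ext fun m => by
    change E.trace 1 • m = m
    rw [h, one_smul])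

/-- If `∑ xᵢ yᵢ` is a unit which is an integer multiple of the identity, every module is a
retract of the coextension of its restriction. -/
lemma nonempty_retract_coextend_restrict {n : ℕ} (h : ∑ i, E.x i * E.y i = n)
    (hn : IsUnit (n : S)) (N : ModuleCat.{u} S) :
    Nonempty (Retract N ((coextendScalars φ).obj ((restrictScalars φ).obj N))) := by
  obtain ⟨c, hc⟩ := hn
  -- Unit followed by counit is multiplication by `n`. Integers are central, so division by `n` is
  -- `S`-linear and corrects the composite to the identity.
  have hcomm : ∀ s : S, Commute s ((c⁻¹ : Sˣ) : S) := fun s =>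
    Commute.units_inv_right (by rw [hc]; exact Nat.commute_cast s n)
  let e : N ⟶ N := ofHom
    { toFun := fun m => ((c⁻¹ : Sˣ) : S) • m
      map_add' := fun _ _ => smul_add _ _ _
      map_smul' := fun s m => by
        rw [RingHom.id_apply, smul_smul, smul_smul, (hcomm s).eq] }
  refine ⟨⟨(restrictCoextendScalarsAdj φ).unit.app N, E.counitMap N ≫ e,
    ModuleCat.hom_ext (LinearMap.ext fun m => ?_)⟩⟩
  change ((c⁻¹ : Sˣ) : S) • ∑ i, E.x i • E.y i • m = m
  simp_rw [smul_smul]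
  rw [← Finset.sum_smul, h, smul_smul, ← hc, Units.inv_mul, one_smul]

end FrobeniusSystem
end Frobenius

/-! ### Exactness, projectives and finiteness under restriction and coextension -/

section TransposeFrobenius

open ModuleCat

universe w

open scoped ZeroObject in
lemma ExtVanishes.of_retract {R : Type u} [Ring R] {T T' X : ModuleCat.{u} R} {k : ℕ}
    (h : ExtVanishes T' X k) (r : Retract T T') : ExtVanishes T X k :=
  h.of_stable_retract (P := (0 : ModuleCat.{u} R)) r.i r.r 0 0
    (by rw [r.retract, Limits.comp_zero, add_zero])

/-- An exact functor between module categories preserves exactness of pairs of maps. -/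
lemma ModuleCat.map_exact {R S : Type*} [Ring R] [Ring S] {K : ModuleCat.{u} R ⥤ ModuleCat.{v} S}
    [K.PreservesZeroMorphisms] [Limits.PreservesFiniteLimits K] [Limits.PreservesFiniteColimits K]
    {A B C : ModuleCat.{u} R} {f : A ⟶ B} {g : B ⟶ C} (h : Function.Exact f g) :
    Function.Exact (K.map f) (K.map g) := by
  have hfg : f ≫ g = 0 := ModuleCat.hom_ext (h.linearMap_comp_eq_zero)
  have hS : (ShortComplex.mk f g hfg).Exact :=
    (ShortComplex.ShortExact.moduleCat_exact_iff_function_exact _).2 h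
  exact (ShortComplex.ShortExact.moduleCat_exact_iff_function_exact _).1 (hS.map K)

lemma ModuleCat.map_surjective {R S : Type*} [Ring R] [Ring S]
    {K : ModuleCat.{u} R ⥤ ModuleCat.{v} S} [K.PreservesEpimorphisms]
    {A B : ModuleCat.{u} R} {f : A ⟶ B} (h : Function.Surjective f) :
    Function.Surjective (K.map f) := by
  have := (ModuleCat.epi_iff_surjective f).2 h
  exact (ModuleCat.epi_iff_surjective _).1 inferInstance

namespace ProjPresentation

variable {R : Type u} [Ring R] {M : ModuleCat.{u} R} (ε : ProjPresentation R M)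

/-- The dual of the map of a presentation. -/
noncomputable def dualMap : of Rᵐᵒᵖ (ε.P₀ →ₗ[R] R) ⟶ of Rᵐᵒᵖ (ε.P₁ →ₗ[R] R) :=
  ofHom (LinearMap.lcomp Rᵐᵒᵖ R ε.f)

/-- The projection onto the transpose. -/
noncomputable def toTranspose : of Rᵐᵒᵖ (ε.P₁ →ₗ[R] R) ⟶ ε.transpose :=
  ofHom (Submodule.mkQ _)

lemma dualMap_exact : Function.Exact ε.dualMap ε.toTranspose :=
  LinearMap.exact_iff.2 (Submodule.ker_mkQ _)

lemma toTranspose_surjective : Function.Surjective ε.toTranspose :=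
  Submodule.mkQ_surjective _

/-- The universal property of the transpose as a cokernel. -/
lemma nonempty_transpose_iso {A₀ A₁ T : ModuleCat.{u} Rᵐᵒᵖ} (e₀ : of Rᵐᵒᵖ (ε.P₀ →ₗ[R] R) ≅ A₀)
    (e₁ : of Rᵐᵒᵖ (ε.P₁ →ₗ[R] R) ≅ A₁) {d : A₀ ⟶ A₁} {q : A₁ ⟶ T}
    (hcomm : ε.dualMap ≫ e₁.hom = e₀.hom ≫ d) (hex : Function.Exact d q)
    (hq : Function.Surjective q) : Nonempty (ε.transpose ≅ T) := by
  have he₁ : Function.Bijective e₁.hom := ConcreteCategory.bijective_of_isIso e₁.hom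
  have he₀ : Function.Bijective e₀.hom := ConcreteCategory.bijective_of_isIso e₀.hom
  have h : Function.Exact (LinearMap.lcomp Rᵐᵒᵖ R ε.f) (e₁.hom ≫ q).hom := by
    intro α
    have hc : ∀ β, e₁.hom (ε.dualMap β) = d (e₀.hom β) := fun β => by
      rw [← ModuleCat.comp_apply, hcomm, ModuleCat.comp_apply]
    refine (hex (e₁.hom α)).trans ⟨?_, ?_⟩
    · rintro ⟨b, hb⟩
      obtain ⟨β, rfl⟩ := he₀.2 b
      exact ⟨β, he₁.1 ((hc β).trans hb)⟩
    · rintro ⟨β, rfl⟩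
      exact ⟨e₀.hom β, (hc β).symm⟩
  exact ⟨(h.linearEquivOfSurjective (hq.comp he₁.2)).toModuleIso⟩

end ProjPresentation

namespace FrobeniusSystem

variable {R S : Type u} [Ring R] [Ring S]

/-- Here and in the next lemma the adjunction that exists for every `φ` suffices; the complementary
halves of exactness come from the adjunction supplied by the Frobenius system. -/
lemma restrict_finite_colimits (φ : R →+* S) :
    Limits.PreservesFiniteColimits (restrictScalars.{u} φ) :=
  have := (restrictCoextendScalarsAdj.{u, u, u} φ).leftAdjoint_preservesColimits
  inferInstance

lemma coextend_finite_limits (φ : R →+* S) :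
    Limits.PreservesFiniteLimits (coextendScalars.{u, u, u} φ) :=
  have := (restrictCoextendScalarsAdj.{u, u, u} φ).rightAdjoint_preservesLimits
  inferInstance

variable {ι : Type w} [Fintype ι] {φ : R →+* S}

lemma restrict_finite_limits (E : FrobeniusSystem φ ι) :
    Limits.PreservesFiniteLimits (restrictScalars.{u} φ) :=
  have := E.coextendRestrictAdj.rightAdjoint_preservesLimits
  inferInstance

lemma coextend_finite_colimits (E : FrobeniusSystem φ ι) :
    Limits.PreservesFiniteColimits (coextendScalars.{u, u, u} φ) :=
  have := E.coextendRestrictAdj.leftAdjoint_preservesColimits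
  inferInstance

/-- A left adjoint whose right adjoint preserves epimorphisms preserves projectives. -/
lemma restrict_projective (E : FrobeniusSystem φ ι) :
    (restrictScalars.{u} φ).PreservesProjectiveObjects :=
  have := E.coextend_finite_colimits
  Functor.preservesProjectiveObjects_of_adjunction_of_preservesEpimorphisms
    (restrictCoextendScalarsAdj.{u, u, u} φ)

lemma coextend_projective (E : FrobeniusSystem φ ι) :
    (coextendScalars.{u, u, u} φ).PreservesProjectiveObjects :=
  Functor.preservesProjectiveObjects_of_adjunction_of_preservesEpimorphisms E.coextendRestrictAdj

lemma coextend_additive (E : FrobeniusSystem φ ι) : (coextendScalars.{u, u, u} φ).Additive :=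
  E.coextendRestrictAdj.left_adjoint_additive

/-- The `y i` generate `S` as a left `R`-module, and finiteness is transitive. -/
lemma restrict_module_finite (E : FrobeniusSystem φ ι) (N : ModuleCat.{u} S) [Module.Finite S N] :
    Module.Finite R ((restrictScalars φ).obj N) := by
  let : Module R S := Module.compHom S φ
  let : Module R N := Module.compHom N φ
  have : IsScalarTower R S N := ⟨fun r s n => mul_smul (φ r) s n⟩
  have : Module.Finite R S := by
    classical
    refine ⟨⟨Finset.univ.image E.y, eq_top_iff.2 fun s _ => ?_⟩⟩
    rw [← E.sum_left s]
    exact Submodule.sum_mem _ fun i _ => Submodule.smul_mem _ (E.trace (s * E.x i))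
      (Submodule.subset_span (by simp))
  have : Module.Finite R N := Module.Finite.trans S N
  exact this

/-- A triangle identity read elementwise. It shows that the image of the unit generates the
coextension over `S`, so that `S`-linear maps out of it are determined on that image. -/
lemma coextend_eq_sum (E : FrobeniusSystem φ ι) (M : ModuleCat.{u} R)
    (f : (coextendScalars φ).obj M) :
    f = ∑ i, E.x i • (show (coextendScalars φ).obj M from (E.unitMap M).hom (f (E.y i))) :=
  (LinearMap.congr_fun (congrArg ModuleCat.Hom.hom
    (E.coextendRestrictAdj.left_triangle_components M)) f).symm

lemma coextend_module_finite (E : FrobeniusSystem φ ι) (M : ModuleCat.{u} R) [Module.Finite R M] :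
    Module.Finite S ((coextendScalars φ).obj M) := by
  obtain ⟨s, hs⟩ := Module.Finite.fg_top (R := R) (M := M)
  classical
  let j : M → (coextendScalars φ).obj M := fun m => (E.unitMap M).hom m
  refine ⟨⟨s.image j, eq_top_iff.2 fun f _ => ?_⟩⟩
  have h : ∀ m : M, j m ∈ Submodule.span S ((s.image j : Finset _) : Set _) := by
    intro m
    have hm : m ∈ Submodule.span R (s : Set M) := hs ▸ Submodule.mem_top
    induction hm using Submodule.span_induction with
    | mem m hm => exact Submodule.subset_span (by simpa using ⟨m, hm, rfl⟩)
    | zero =>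
      have : j 0 = 0 := map_zero (E.unitMap M).hom
      exact this ▸ Submodule.zero_mem _
    | add a b _ _ ha hb =>
      have : j (a + b) = j a + j b := map_add (E.unitMap M).hom a b
      exact this ▸ Submodule.add_mem _ ha hb
    | smul r a _ ha =>
      have : j (r • a) = φ r • j a := map_smul (E.unitMap M).hom r a
      exact this ▸ Submodule.smul_mem _ _ ha
  rw [E.coextend_eq_sum M f]
  exact Submodule.sum_mem _ fun i _ => Submodule.smul_mem _ _ (h _)

end FrobeniusSystem
end TransposeFrobenius

/-! ### Duals commute with restriction and coextension -/

noncomputable section TransposeFunctors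

open ModuleCat

universe w

/-- The image of a presentation under an exact functor preserving finitely generated
projectives. -/
def ProjPresentation.map {R S : Type u} [Ring R] [Ring S] {M : ModuleCat.{u} R}
    (ε : ProjPresentation R M) (K : ModuleCat.{u} R ⥤ ModuleCat.{u} S)
    [K.PreservesZeroMorphisms] [Limits.PreservesFiniteLimits K] [Limits.PreservesFiniteColimits K]
    [K.PreservesProjectiveObjects]
    (hK : ∀ N : ModuleCat.{u} R, Module.Finite R N → Module.Finite S (K.obj N)) :
    ProjPresentation S (K.obj M) where
  P₁ := K.obj ε.P₁
  P₀ := K.obj ε.P₀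
  finite₁ := hK _ ε.finite₁
  finite₀ := hK _ ε.finite₀
  projective₁ := (IsProjective.iff_projective _).2 (K.projective_obj_of_projective
    ((IsProjective.iff_projective _).1 ε.projective₁))
  projective₀ := (IsProjective.iff_projective _).2 (K.projective_obj_of_projective
    ((IsProjective.iff_projective _).1 ε.projective₀))
  f := (K.map (ofHom ε.f)).hom
  π := (K.map (ofHom ε.π)).hom
  exact := ModuleCat.map_exact (f := ofHom ε.f) (g := ofHom ε.π) ε.exact
  surjective := ModuleCat.map_surjective (f := ofHom ε.π) ε.surjective

namespace FrobeniusSystem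

variable {ι : Type w} [Fintype ι] {R S : Type u} [Ring R] [Ring S] {φ : R →+* S}
  (E : FrobeniusSystem φ ι)

/-- Composition with the trace, as a map from the `S`-dual to the `R`-dual of an `S`-module. -/
def traceDual (P : ModuleCat.{u} S) :
    (restrictScalars (RingHom.op φ)).obj (of Sᵐᵒᵖ (P →ₗ[S] S)) ⟶
      of Rᵐᵒᵖ ((restrictScalars φ).obj P →ₗ[R] R) :=
  ofHom (X := (restrictScalars (RingHom.op φ)).obj (of Sᵐᵒᵖ (P →ₗ[S] S)))
    { toFun := fun (α : P →ₗ[S] S) =>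
        { toFun := fun (p : P) => E.trace (α p)
          map_add' := fun _ _ =>
            (congrArg E.trace (map_add α _ _)).trans (E.trace.map_add _ _)
          map_smul' := fun r _ =>
            (congrArg E.trace (map_smul α (φ r) _)).trans (E.trace_left _ _) }
      map_add' := fun (α β : P →ₗ[S] S) => LinearMap.ext fun p => E.trace.map_add (α p) (β p)
      map_smul' := fun r (α : P →ₗ[S] S) => LinearMap.ext fun p => E.trace_right (α p) r.unop }

/-- The dual bases recover `α` from its trace: `α p = ∑ x i * φ (trace (α (y i • p)))`. The same
formula inverts the map. -/
lemma traceDual_bijective (P : ModuleCat.{u} S) : Function.Bijective (E.traceDual P) := by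
  constructor
  · refine (injective_iff_map_eq_zero (E.traceDual P).hom).2 fun (α : P →ₗ[S] S) hα => ?_
    refine LinearMap.ext fun p => ?_
    rw [← E.sum_right (α p)]
    refine Finset.sum_eq_zero fun i _ => ?_
    have : E.trace (α (E.y i • p)) = 0 := LinearMap.congr_fun hα (E.y i • p)
    rw [map_smul, smul_eq_mul] at this
    rw [this, map_zero, mul_zero]
  · intro (β : (restrictScalars φ).obj P →ₗ[R] R)
    let j : of R R ⟶ (restrictScalars φ).obj (of S S) :=
      ofHom (Y := (restrictScalars φ).obj (of S S))
        { toFun := φ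
          map_add' := φ.map_add
          map_smul' := φ.map_mul }
    -- This is `p ↦ ∑ x i * φ (β (y i • p))`, assembled from the adjunctions so that `S`-linearity
    -- is automatic.
    let a : P ⟶ of S S :=
      RestrictionCoextensionAdj.HomEquiv.fromRestriction φ
        (ofHom (X := (restrictScalars φ).obj P) β ≫ j) ≫ E.counitMap (of S S)
    refine ⟨a.hom, LinearMap.ext fun (p : P) => ?_⟩
    change E.trace (∑ i, E.x i * φ (β (E.y i • p))) = β p
    have h : ∑ i, φ (E.trace (E.x i)) • E.y i • p = p := by
      have h := E.sum_left 1
      simp only [one_mul] at h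
      conv_rhs => rw [← one_smul S p, ← h, Finset.sum_smul]
      exact Finset.sum_congr rfl fun i _ => (mul_smul _ _ _).symm
    conv_rhs => rw [← h]
    refine (map_sum E.trace _ _).trans (Eq.trans ?_ (map_sum β _ _).symm)
    refine Finset.sum_congr rfl fun i _ => ?_
    rw [E.trace_right]
    exact (β.map_smul (E.trace (E.x i)) (E.y i • p)).symm

/-- The dual of the restriction is the restriction of the dual. -/
def dualRestrictIso (P : ModuleCat.{u} S) : of Rᵐᵒᵖ ((restrictScalars φ).obj P →ₗ[R] R) ≅
    (restrictScalars (RingHom.op φ)).obj (of Sᵐᵒᵖ (P →ₗ[S] S)) :=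
  (LinearEquiv.ofBijective (E.traceDual P).hom (E.traceDual_bijective P)).toModuleIso.symm

/-- The map from the `S`-dual of the coextension of `P` to the `R`-dual of `P`. -/
def coextendDualAux (P : ModuleCat.{u} R) :
    (restrictScalars (RingHom.op φ)).obj
      (of Sᵐᵒᵖ ((coextendScalars φ).obj P →ₗ[S] S)) ⟶ of Rᵐᵒᵖ (P →ₗ[R] R) :=
  ofHom (X := (restrictScalars (RingHom.op φ)).obj
      (of Sᵐᵒᵖ ((coextendScalars φ).obj P →ₗ[S] S)))
    { toFun := fun (θ : (coextendScalars φ).obj P →ₗ[S] S) =>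
        { toFun := fun p => E.trace (θ ((E.unitMap P).hom p))
          map_add' := fun p q => by
            rw [map_add]
            exact (congrArg E.trace (map_add θ _ _)).trans (E.trace.map_add _ _)
          map_smul' := fun r p => by
            rw [map_smul]
            exact (congrArg E.trace (map_smul θ (φ r) _)).trans (E.trace_left _ _) }
      map_add' := fun (α β : (coextendScalars φ).obj P →ₗ[S] S) =>
        LinearMap.ext fun p => E.trace.map_add (α _) (β _)
      map_smul' := fun r (α : (coextendScalars φ).obj P →ₗ[S] S) =>
        LinearMap.ext fun p => E.trace_right (α _) r.unop }

/-- The comparison map from the `S`-dual of the coextension to the coextension of the `R`-dual. -/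
def coextendDual (P : ModuleCat.{u} R) :
    of Sᵐᵒᵖ ((coextendScalars φ).obj P →ₗ[S] S) ⟶
      (coextendScalars (RingHom.op φ)).obj (of Rᵐᵒᵖ (P →ₗ[R] R)) :=
  RestrictionCoextensionAdj.HomEquiv.fromRestriction (RingHom.op φ) (E.coextendDualAux P)

/-- The map sends `θ` to `s ↦ p ↦ trace (θ (unit p) * s)`. Injectivity is nondegeneracy of the trace
form together with generation by the image of the unit. -/
lemma coextendDual_bijective (P : ModuleCat.{u} R) : Function.Bijective (E.coextendDual P) := by
  constructor
  · refine (injective_iff_map_eq_zero (E.coextendDual P).hom).2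
      fun (θ : (coextendScalars φ).obj P →ₗ[S] S) hθ => ?_
    let j : P → (coextendScalars φ).obj P := fun p => (E.unitMap P).hom p
    have h : ∀ p : P, θ (j p) = 0 := fun p => by
      have h₀ : ∀ s, E.trace (θ (j p) * s) = 0 := fun s =>
        LinearMap.congr_fun (M := P) (congrArg
          (fun f : (coextendScalars (RingHom.op φ)).obj (of Rᵐᵒᵖ (P →ₗ[R] R)) =>
            (show P →ₗ[R] R from f (MulOpposite.op s))) hθ) p
      rw [← E.sum_left (θ (j p))]
      exact Finset.sum_eq_zero fun i _ => by rw [h₀, map_zero, zero_mul]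
    refine LinearMap.ext fun f => ?_
    rw [E.coextend_eq_sum P f, map_sum]
    refine (Finset.sum_eq_zero fun i _ => ?_).trans (LinearMap.zero_apply _).symm
    exact (map_smul θ _ _).trans ((congrArg _ (h _)).trans (smul_zero _))
  · intro (Φ : (coextendScalars (RingHom.op φ)).obj (of Rᵐᵒᵖ (P →ₗ[R] R)))
    let c : S → P → R := fun s p => (show P →ₗ[R] R from Φ (MulOpposite.op s)) p
    -- A preimage is fixed by its values on the image of the unit. The dual bases force these to be
    -- `∑ φ (c (x i) p) * y i`, and coextension being left adjoint to restriction extends them to an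
    -- `S`-linear map.
    let ψ : P ⟶ (restrictScalars φ).obj (of S S) :=
      ofHom (Y := (restrictScalars φ).obj (of S S))
        { toFun := fun p => ∑ i, φ (c (E.x i) p) * E.y i
          map_add' := fun p q => by
            refine Eq.trans ?_ Finset.sum_add_distrib
            refine Finset.sum_congr rfl fun i _ => ?_
            rw [show c (E.x i) (p + q) = c (E.x i) p + c (E.x i) q from
              map_add (show P →ₗ[R] R from _) p q, map_add, add_mul]
            rfl
          map_smul' := fun r p => by
            refine Eq.trans ?_ (Finset.mul_sum Finset.univ _ (φ r)).symm
            refine Finset.sum_congr rfl fun i _ => ?_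
            rw [show c (E.x i) (r • p) = r * c (E.x i) p from
              map_smul (show P →ₗ[R] R from _) r p, map_mul, mul_assoc] }
    refine ⟨((E.coextendRestrictAdj.homEquiv _ _).symm ψ).hom, CoextendScalars.ext
      (LinearMap.ext fun s : Sᵐᵒᵖ => LinearMap.ext fun p : P => ?_)⟩
    have hψ : ((E.coextendRestrictAdj.homEquiv _ _).symm ψ).hom ((E.unitMap P).hom p) =
        ∑ i, φ (c (E.x i) p) * E.y i := ConcreteCategory.congr_hom
      ((E.coextendRestrictAdj.homEquiv _ _).apply_symm_apply ψ) p
    change E.trace ((show S from ((E.coextendRestrictAdj.homEquiv _ _).symm ψ).hom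
      ((E.unitMap P).hom p)) * s.unop) = c s.unop p
    have hs : ∀ (t : S) (r : R), c (t * φ r) p = c t p * r := fun t r =>
      LinearMap.congr_fun ((CoextendScalars.equiv (RingHom.op φ) _ Φ).map_smul
        (MulOpposite.op r) (MulOpposite.op t)) p
    have ha : c s.unop p = ∑ i, c (E.x i * φ (E.trace (E.y i * s.unop))) p := by
      let C : S →+ R :=
        { toFun := fun t => c t p
          map_zero' := LinearMap.congr_fun (map_zero (CoextendScalars.equiv (RingHom.op φ) _ Φ)) p
          map_add' := fun t t' => LinearMap.congr_fun
            (map_add (CoextendScalars.equiv (RingHom.op φ) _ Φ)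
              (MulOpposite.op t) (MulOpposite.op t')) p }
      conv_lhs => rw [← E.sum_right s.unop]
      exact map_sum C _ _
    rw [ha]
    refine (congrArg (fun z : S => E.trace (z * s.unop)) hψ).trans ?_
    rw [Finset.sum_mul, map_sum]
    refine Finset.sum_congr rfl fun i _ => ?_
    rw [hs, mul_assoc, E.trace_left]

/-- The dual of the coextension is the coextension of the dual. -/
def dualCoextendIso (P : ModuleCat.{u} R) : of Sᵐᵒᵖ ((coextendScalars φ).obj P →ₗ[S] S) ≅
    (coextendScalars (RingHom.op φ)).obj (of Rᵐᵒᵖ (P →ₗ[R] R)) :=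
  (LinearEquiv.ofBijective (E.coextendDual P).hom (E.coextendDual_bijective P)).toModuleIso

end FrobeniusSystem
end TransposeFunctors

/-! ### Transfer of `k`-torsionfree modules -/

noncomputable section TorsionfreeTransfer

open ModuleCat

universe w

/-- The left and right regular structures give isomorphic right modules. -/
def rightRegularIso (R : Type u) [Ring R] : of Rᵐᵒᵖ R ≅ of Rᵐᵒᵖ Rᵐᵒᵖ :=
  (rightRegularEquiv R).toModuleIso

/-- `dualRestrictIso` is the inverse of composition with the trace, and naturality holds by `rfl`
only in the direction of the latter. -/
lemma comp_hom_eq_hom_comp {C : Type*} [Category* C] {A B A' B' : C} {a : A ≅ A'} {b : B ≅ B'}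
    {d : A ⟶ B} {d' : A' ⟶ B'} (h : a.inv ≫ d = d' ≫ b.inv) : d ≫ b.hom = a.hom ≫ d' := by
  rw [← Iso.inv_comp_eq, ← Category.assoc, h, Category.assoc, Iso.inv_hom_id, Category.comp_id]

namespace FrobeniusSystem

variable {ι : Type w} [Fintype ι] {R S : Type u} [Ring R] [Ring S] {φ : R →+* S}
  (E : FrobeniusSystem φ ι)

/-- The composition of the trace with a right multiplication, as a linear map. -/
def traceMul (t : S) : (restrictScalars φ).obj (of S S) ⟶ of R R :=
  ofHom (X := (restrictScalars φ).obj (of S S))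
    { toFun := fun s : S => E.trace (s * t)
      map_add' := fun s s' : S => (congrArg E.trace (add_mul s s' t)).trans (E.trace.map_add _ _)
      map_smul' := fun r (s : S) =>
        (congrArg E.trace (mul_assoc (φ r) s t)).trans (E.trace_left _ _) }

/-- The composition of the ring homomorphism with a right multiplication, as a linear map. -/
def baseMul (φ : R →+* S) (t : S) : of R R ⟶ (restrictScalars φ).obj (of S S) :=
  ofHom (Y := (restrictScalars φ).obj (of S S))
    { toFun := fun r : R => φ r * t
      map_add' := fun r r' => (congrArg (· * t) (φ.map_add r r')).trans (add_mul _ _ _)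
      map_smul' := fun r r' => (congrArg (· * t) (φ.map_mul r r')).trans (mul_assoc _ _ _) }

/-- The expansion in dual bases, read as exhibiting `S` as a summand of a finite power of `R`. -/
lemma sum_traceMul_baseMul : ∑ i, E.traceMul (E.x i) ≫ baseMul φ (E.y i) =
    𝟙 ((restrictScalars φ).obj (of S S)) := by
  refine ModuleCat.hom_ext (LinearMap.ext fun s : S => ?_)
  rw [ModuleCat.hom_sum]
  exact (LinearMap.sum_apply (M := (restrictScalars φ).obj (of S S)) _ _ s).trans (E.sum_left s)

/-- The coextension of the base ring is a retract of the extension ring. -/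
def coextendBaseRetract : Retract ((coextendScalars φ).obj (of R R)) (of S S) where
  i := (coextendScalars φ).map (baseMul φ 1) ≫ E.counitMap (of S S)
  r := RestrictionCoextensionAdj.HomEquiv.fromRestriction φ (E.traceMul 1)
  retract := by
    refine ModuleCat.hom_ext (LinearMap.ext fun f => CoextendScalars.ext
      (LinearMap.ext fun t : S => ?_))
    change E.trace (t * (∑ i, E.x i * (φ (f (E.y i)) * 1)) * 1) = f t
    refine Eq.trans ?_ (E.coextend_apply_eq _ f t).symm
    simp_rw [mul_one, Finset.mul_sum]
    rw [map_sum]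
    refine Finset.sum_congr rfl fun i _ => ?_
    rw [← mul_assoc, E.trace_right]
    rfl

/-- The transpose of the restriction is the restriction of the transpose. By adjunction over the
opposite rings, its Ext-vanishing into `R` follows from that of the transpose of `N` into the
coextension of `R`, a summand of `S`. -/
lemma TF_restrict (E : FrobeniusSystem φ ι) {k : ℕ} {N : ModuleCat.{u} S} (h : TF S k N) :
    TF R k ((restrictScalars φ).obj N) := by
  obtain ⟨hN, ε, hε⟩ := h
  have := E.restrict_finite_limits
  have := restrict_finite_colimits φ
  have := E.restrict_projective
  have := E.op.restrict_finite_limits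
  have := restrict_finite_colimits (RingHom.op φ)
  have := E.op.restrict_projective
  let ε' := ε.map (restrictScalars φ) fun N _ => E.restrict_module_finite N
  refine ⟨E.restrict_module_finite N, ε', ?_⟩
  obtain ⟨e⟩ := ε'.nonempty_transpose_iso (E.dualRestrictIso ε.P₀) (E.dualRestrictIso ε.P₁)
    (d := (restrictScalars (RingHom.op φ)).map ε.dualMap)
    (q := (restrictScalars (RingHom.op φ)).map ε.toTranspose)
    (comp_hom_eq_hom_comp (a := E.dualRestrictIso ε.P₀) (b := E.dualRestrictIso ε.P₁)
      (d := ε'.dualMap) (d' := (restrictScalars (RingHom.op φ)).map ε.dualMap) rfl)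
    (ModuleCat.map_exact ε.dualMap_exact) (ModuleCat.map_surjective ε.toTranspose_surjective)
  have h₁ : ExtVanishes ε.transpose ((coextendScalars (RingHom.op φ)).obj (of Rᵐᵒᵖ R)) k := by
    refine ExtVanishes.of_sum_factor (ι := Unit) hε
      (fun _ => (coextendScalars (RingHom.op φ)).map (rightRegularIso R).hom ≫
        E.op.coextendBaseRetract.i ≫ (rightRegularIso S).inv)
      (fun _ => (rightRegularIso S).hom ≫ E.op.coextendBaseRetract.r ≫
        (coextendScalars (RingHom.op φ)).map (rightRegularIso R).inv) ?_
    simp [← Functor.map_comp]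
  exact (h₁.of_adjunction (restrictCoextendScalarsAdj (RingHom.op φ))).of_retract e.retract

/-- Mirror image, with the Frobenius adjunction: the coefficients become the restriction of `S`,
whose identity is a sum of maps through `R`. -/
lemma TF_coextend (E : FrobeniusSystem φ ι) {k : ℕ} {M : ModuleCat.{u} R} (h : TF R k M) :
    TF S k ((coextendScalars φ).obj M) := by
  obtain ⟨hM, ε, hε⟩ := h
  have := coextend_finite_limits φ
  have := E.coextend_finite_colimits
  have := E.coextend_projective
  have := E.coextend_additive
  have := coextend_finite_limits (RingHom.op φ)
  have := E.op.coextend_finite_colimits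
  have := E.op.coextend_projective
  have := E.op.coextend_additive
  let ε' := ε.map (coextendScalars φ) fun M _ => E.coextend_module_finite M
  refine ⟨E.coextend_module_finite M, ε', ?_⟩
  have hη : ∀ p : ε.P₁, (show (coextendScalars φ).obj ε.P₀ from
      ((coextendScalars φ).map (ofHom ε.f)).hom ((E.unitMap ε.P₁).hom p)) =
        (E.unitMap ε.P₀).hom (ε.f p) := fun p =>
    (ConcreteCategory.congr_hom (E.coextendRestrictAdj.unit.naturality (ofHom ε.f)) p).symm
  obtain ⟨e⟩ := ε'.nonempty_transpose_iso (E.dualCoextendIso ε.P₀) (E.dualCoextendIso ε.P₁)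
    (d := (coextendScalars (RingHom.op φ)).map ε.dualMap)
    (q := (coextendScalars (RingHom.op φ)).map ε.toTranspose)
    (ModuleCat.hom_ext (LinearMap.ext fun (θ : (coextendScalars φ).obj ε.P₀ →ₗ[S] S) =>
      CoextendScalars.ext (LinearMap.ext fun s : Sᵐᵒᵖ => LinearMap.ext fun p : ε.P₁ =>
        congrArg (fun z => E.trace (θ z * s.unop)) (hη p))))
    (ModuleCat.map_exact ε.dualMap_exact)
    (ModuleCat.map_surjective ε.toTranspose_surjective)
  have h₁ : ExtVanishes ε.transpose ((restrictScalars (RingHom.op φ)).obj (of Sᵐᵒᵖ S)) k := by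
    refine ExtVanishes.of_sum_factor hε
      (fun i => (restrictScalars (RingHom.op φ)).map (rightRegularIso S).hom ≫
        E.op.traceMul (E.op.x i) ≫ (rightRegularIso R).inv)
      (fun i => (rightRegularIso R).hom ≫ baseMul (RingHom.op φ) (E.op.y i) ≫
        (restrictScalars (RingHom.op φ)).map (rightRegularIso S).inv) ?_
    simp only [Category.assoc, Iso.inv_hom_id_assoc]
    rw [← Preadditive.comp_sum]
    simp_rw [← Category.assoc (E.op.traceMul _)]
    rw [← Preadditive.sum_comp, E.op.sum_traceMul_baseMul, Category.id_comp, ← Functor.map_comp,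
      Iso.hom_inv_id, CategoryTheory.Functor.map_id]
  exact (h₁.of_adjunction E.op.coextendRestrictAdj).of_retract e.retract

end FrobeniusSystem
end TorsionfreeTransfer

/-! ### Gorenstein modules, defined coinductively -/

section Gorenstein

open ModuleCat

variable {R : Type u} [Ring R]

/-- `A` is a syzygy of `B` with projective middle term. -/
def ProjectiveStep (A B : ModuleCat.{u} R) : Prop :=
  ∃ (P : ModuleCat.{u} R) (i : A ⟶ P) (p : P ⟶ B), Projective P ∧ Function.Injective i ∧
    Function.Exact i p ∧ Function.Surjective p

lemma ModuleCat.shortExact_of_exact {A B C : ModuleCat.{u} R} {i : A ⟶ B} {p : B ⟶ C}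
    (hi : Function.Injective i) (h : Function.Exact i p) (hp : Function.Surjective p) :
    (ShortComplex.mk i p (ModuleCat.hom_ext h.linearMap_comp_eq_zero)).ShortExact where
  exact := (ShortComplex.ShortExact.moduleCat_exact_iff_function_exact _).2 h
  mono_f := (ModuleCat.mono_iff_injective _).2 hi
  epi_g := (ModuleCat.epi_iff_surjective _).2 hp

/-- All positive `Ext` groups into projective modules vanish. -/
def ExtProjVanishes (M : ModuleCat.{u} R) : Prop :=
  ∀ (Q : ModuleCat.{u} R) (k : ℕ), Projective Q → ExtVanishes M Q k

/-- A class of modules all of whose members have vanishing `Ext` into projectives and embed into a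
projective with cokernel in the class. -/
def IsGorensteinClass (𝒢 : ModuleCat.{u} R → Prop) : Prop :=
  ∀ M, 𝒢 M → ExtProjVanishes M ∧ ∃ B, 𝒢 B ∧ ProjectiveStep M B

/-- Members of some class as in `IsGorensteinClass`; these are the Gorenstein projective modules. -/
def IsGorenstein (M : ModuleCat.{u} R) : Prop :=
  ∃ 𝒢, IsGorensteinClass 𝒢 ∧ 𝒢 M

/-- A union of such classes is again one, so there is a largest. Closure properties are then proved
by exhibiting a class that contains the module. -/
lemma isGorensteinClass_isGorenstein : IsGorensteinClass (IsGorenstein (R := R)) := by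
  rintro M ⟨𝒢, h𝒢, hM⟩
  obtain ⟨h, B, hB, hs⟩ := h𝒢 M hM
  exact ⟨h, B, ⟨𝒢, h𝒢, hB⟩, hs⟩

lemma ExtVanishes.exists_extension {A E B Q : ModuleCat.{u} R} (h : ExtVanishes B Q 1)
    {i : A ⟶ E} {p : E ⟶ B} (hi : Function.Injective i) (hip : Function.Exact i p)
    (hp : Function.Surjective p) (g : A ⟶ Q) : ∃ e : E ⟶ Q, i ≫ e = g := by
  have := h 1 le_rfl le_rfl
  obtain ⟨x, hx⟩ := Abelian.Ext.contravariant_sequence_exact₁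
    (ModuleCat.shortExact_of_exact hi hip hp) Q (Abelian.Ext.mk₀ g) (add_zero 1)
    (Subsingleton.elim _ _)
  obtain ⟨x, rfl⟩ := Abelian.Ext.mk₀_bijective _ _ |>.2 x
  rw [Abelian.Ext.mk₀_comp_mk₀] at hx
  exact ⟨x, Abelian.Ext.mk₀_bijective _ _ |>.1 hx⟩

lemma ExtVanishes.of_extension {A E B Q : ModuleCat.{u} R} {k : ℕ} (hA : ExtVanishes A Q k)
    (hB : ExtVanishes B Q k) {i : A ⟶ E} {p : E ⟶ B} (hi : Function.Injective i)
    (hip : Function.Exact i p) (hp : Function.Surjective p) : ExtVanishes E Q k := by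
  intro l h₁ h₂
  have := hA l h₁ h₂
  have := hB l h₁ h₂
  refine subsingleton_of_forall_eq 0 fun e => ?_
  obtain ⟨x, rfl⟩ := Abelian.Ext.contravariant_sequence_exact₂
    (ModuleCat.shortExact_of_exact hi hip hp) Q e (Subsingleton.elim _ _)
  rw [Subsingleton.elim x 0, Abelian.Ext.comp_zero]

/-- Gorenstein modules are closed under extensions. -/
lemma IsGorenstein.of_extension {A E B : ModuleCat.{u} R} (hA : IsGorenstein A)
    (hB : IsGorenstein B) {i : A ⟶ E} {p : E ⟶ B} (hi : Function.Injective i)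
    (hip : Function.Exact i p) (hp : Function.Surjective p) : IsGorenstein E := by
  refine ⟨fun E => ∃ (A B : ModuleCat.{u} R) (i : A ⟶ E) (p : E ⟶ B), IsGorenstein A ∧
    IsGorenstein B ∧ Function.Injective i ∧ Function.Exact i p ∧ Function.Surjective p, ?_,
    A, B, i, p, hA, hB, hi, hip, hp⟩
  clear! A E B
  rintro E ⟨A, B, i, p, hA, hB, hi, hip, hp⟩
  obtain ⟨hA₁, A', hA', P, a, a', hP, ha, haa', ha'⟩ := isGorensteinClass_isGorenstein A hA
  obtain ⟨hB₁, B', hB', Q, b, b', hQ, hb, hbb', hb'⟩ := isGorensteinClass_isGorenstein B hB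
  refine ⟨fun X k hX => (hA₁ X k hX).of_extension (hB₁ X k hX) hi hip hp, ?_⟩
  -- Horseshoe construction: the embedding of `A` into `P` extends to `E` because `Ext¹(B, P) = 0`.
  -- Then `E` embeds in `P × Q` with cokernel an extension of `B'` by `A'`.
  obtain ⟨t, ht⟩ := (hB₁ P 1 hP).exists_extension hi hip hp a
  have ht : ∀ x, t (i x) = a x := fun x => ConcreteCategory.congr_hom ht x
  let m : E →ₗ[R] P × Q := t.hom.prod (p ≫ b).hom
  have hm : ∀ x, m x = (t x, b (p x)) := fun _ => rfl
  let f : A' →ₗ[R] (P × Q) ⧸ LinearMap.range m :=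
    (Submodule.liftQ (LinearMap.range a.hom)
      ((LinearMap.range m).mkQ ∘ₗ LinearMap.inl R P Q) (by
        rintro _ ⟨x, rfl⟩
        refine (Submodule.Quotient.mk_eq_zero _).2 ⟨i x, ?_⟩
        rw [hm, ht, hip.apply_apply_eq_zero, map_zero]
        rfl)) ∘ₗ (Function.Exact.linearEquivOfSurjective (f := a.hom) (g := a'.hom)
          haa' ha').symm.toLinearMap
  have hf : ∀ x : P, f (a' x) = Submodule.Quotient.mk (x, 0) := by
    intro x
    have : (Function.Exact.linearEquivOfSurjective (f := a.hom) (g := a'.hom)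
        haa' ha').symm (a' x) = Submodule.Quotient.mk x := by
      rw [LinearEquiv.symm_apply_eq]
      rfl
    simp only [f, LinearMap.comp_apply, LinearEquiv.coe_coe, this]
    rfl
  let g : (P × Q) ⧸ LinearMap.range m →ₗ[R] B' :=
    Submodule.liftQ _ (b'.hom ∘ₗ LinearMap.snd R P Q) (by
      rintro _ ⟨x, rfl⟩
      exact hbb'.apply_apply_eq_zero (p x))
  have hg : ∀ x y, g (Submodule.Quotient.mk (x, y)) = b' y := fun _ _ => rfl
  refine ⟨of R ((P × Q) ⧸ LinearMap.range m), ⟨A', B', ofHom f, ofHom g, hA', hB', ?_, ?_, ?_⟩,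
    of R (P × Q), ofHom m, ofHom (Submodule.mkQ _), ?_, ?_, ?_, Submodule.mkQ_surjective _⟩
  · refine (injective_iff_map_eq_zero f).2 fun z hz => ?_
    obtain ⟨x, rfl⟩ := ha' z
    rw [hf, Submodule.Quotient.mk_eq_zero] at hz
    obtain ⟨e, he⟩ := hz
    rw [hm, Prod.mk.injEq] at he
    obtain ⟨y, rfl⟩ := (hip e).1 (hb (he.2.trans (map_zero b.hom).symm))
    rw [← he.1, ht]
    exact haa'.apply_apply_eq_zero y
  · refine fun z => ⟨fun hz => ?_, ?_⟩
    · obtain ⟨⟨x, y⟩, rfl⟩ := Submodule.mkQ_surjective _ z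
      obtain ⟨w, rfl⟩ := (hbb' y).1 hz
      obtain ⟨e, rfl⟩ := hp w
      refine ⟨a' (x - t e), (hf _).trans ((Submodule.Quotient.eq _).2 ⟨-e, ?_⟩)⟩
      rw [map_neg, hm]
      ext <;> simp
    · rintro ⟨w, rfl⟩
      obtain ⟨x, rfl⟩ := ha' w
      change g (f (a' x)) = 0
      rw [hf, hg, map_zero]
  · intro y
    obtain ⟨z, rfl⟩ := hb' y
    exact ⟨Submodule.Quotient.mk (0, z), rfl⟩
  · have := (IsProjective.iff_projective _).2 hP
    have := (IsProjective.iff_projective _).2 hQ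
    exact (IsProjective.iff_projective _).1 (inferInstanceAs (Module.Projective R (P × Q)))
  · refine (injective_iff_map_eq_zero m).2 fun z hz => ?_
    rw [hm, Prod.mk_eq_zero] at hz
    obtain ⟨y, rfl⟩ := (hip z).1 (hb (hz.2.trans (map_zero b.hom).symm))
    have : y = 0 := ha ((ht y).symm.trans (hz.1.trans (map_zero a.hom).symm))
    rw [this, map_zero]
  · exact LinearMap.exact_iff.2 (Submodule.ker_mkQ _)

/-- Gorenstein modules are closed under retracts. -/
lemma IsGorenstein.of_retract {M G : ModuleCat.{u} R} (hG : IsGorenstein G) (r : Retract M G) :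
    IsGorenstein M := by
  refine ⟨fun M => ∃ G, IsGorenstein G ∧ Nonempty (Retract M G), ?_, G, hG, ⟨r⟩⟩
  clear! M G
  rintro M ⟨G, hG, ⟨r⟩⟩
  obtain ⟨hG₁, G', hG', P, i, p, hP, hi, hip, hp⟩ := isGorensteinClass_isGorenstein G hG
  refine ⟨fun X k hX => (hG₁ X k hX).of_retract r, ?_⟩
  have hr : ∀ x, r.r (r.i x) = x := fun x => ConcreteCategory.congr_hom r.retract x
  let m : M →ₗ[R] P := (r.i ≫ i).hom
  have hm : ∀ x, m x = i (r.i x) := fun _ => rfl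
  -- The cokernel `P/M` need only be a retract of a Gorenstein module. It is a summand of `P/M × M`,
  -- which is an extension of `G'` by `G`.
  let f : G →ₗ[R] (P ⧸ LinearMap.range m) × M := ((Submodule.mkQ _) ∘ₗ i.hom).prod r.r.hom
  have hf : ∀ x, f x = (Submodule.Quotient.mk (i x), r.r x) := fun _ => rfl
  let g₀ : (P ⧸ LinearMap.range m) →ₗ[R] G' := Submodule.liftQ _ p.hom (by
      rintro _ ⟨x, rfl⟩
      exact hip.apply_apply_eq_zero (r.i x))
  let g : (P ⧸ LinearMap.range m) × M →ₗ[R] G' := g₀ ∘ₗ LinearMap.fst R _ _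
  have hE : IsGorenstein (of R ((P ⧸ LinearMap.range m) × M)) := by
    refine hG.of_extension hG' (i := ofHom f) (p := ofHom g) ?_ ?_ ?_
    · refine (injective_iff_map_eq_zero f).2 fun z hz => ?_
      rw [hf, Prod.mk_eq_zero, Submodule.Quotient.mk_eq_zero] at hz
      obtain ⟨⟨y, hy⟩, hz⟩ := hz
      have hy := hi hy
      rw [← hy] at hz
      have : y = 0 := (hr y).symm.trans hz
      exact hy.symm.trans (by rw [this]; exact map_zero r.i.hom)
    · rintro ⟨z, y⟩
      constructor
      · intro hz
        obtain ⟨x, rfl⟩ := Submodule.mkQ_surjective _ z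
        obtain ⟨w, rfl⟩ := (hip x).1 hz
        -- Altering `w` within the image of `M` keeps its class in `P/M` and makes its retraction
        -- equal to `y`.
        refine ⟨w - r.i (r.r w) + r.i y, Prod.ext ?_ ?_⟩
        · refine (Submodule.Quotient.eq _).2 ⟨y - r.r w, ?_⟩
          rw [hm]
          simp only [map_sub, map_add]
          abel
        · change r.r (w - r.i (r.r w) + r.i y) = y
          rw [map_add, map_sub, hr, hr]
          abel
      · rintro ⟨w, hw⟩
        rw [← hw]
        exact hip.apply_apply_eq_zero w
    · intro y
      obtain ⟨x, rfl⟩ := hp y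
      exact ⟨(Submodule.Quotient.mk x, 0), rfl⟩
  refine ⟨of R (P ⧸ LinearMap.range m), ⟨_, hE, ⟨⟨ofHom (LinearMap.inl R _ _),
    ofHom (LinearMap.fst R _ _), rfl⟩⟩⟩, P, ofHom m, ofHom (Submodule.mkQ _), hP, ?_, ?_,
    Submodule.mkQ_surjective _⟩
  · exact hi.comp (Function.LeftInverse.injective hr)
  · exact LinearMap.exact_iff.2 (Submodule.ker_mkQ _)

/-- Exact left adjoints preserving projectives whose right adjoints preserve projectives preserve
Gorenstein modules. -/
lemma IsGorenstein.map {S : Type u} [Ring S] {L : ModuleCat.{u} R ⥤ ModuleCat.{u} S}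
    {H : ModuleCat.{u} S ⥤ ModuleCat.{u} R} (adj : L ⊣ H) [L.PreservesZeroMorphisms]
    [Limits.PreservesFiniteLimits L] [Limits.PreservesFiniteColimits L]
    [L.PreservesProjectiveObjects] [H.PreservesProjectiveObjects] {M : ModuleCat.{u} R}
    (hM : IsGorenstein M) : IsGorenstein (L.obj M) := by
  refine ⟨fun N => ∃ M, IsGorenstein M ∧ L.obj M = N, ?_, M, hM, rfl⟩
  rintro _ ⟨M, hM, rfl⟩
  obtain ⟨hM₁, B, hB, P, i, p, hP, hi, hip, hp⟩ := isGorensteinClass_isGorenstein M hM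
  refine ⟨fun Q k hQ => (hM₁ (H.obj Q) k (H.projective_obj_of_projective hQ)).of_adjunction adj,
    L.obj B, ⟨B, hB, rfl⟩, L.obj P, L.map i, L.map p, L.projective_obj_of_projective hP, ?_,
    ModuleCat.map_exact hip, ModuleCat.map_surjective hp⟩
  have := (ModuleCat.mono_iff_injective i).2 hi
  exact (ModuleCat.mono_iff_injective _).1 inferInstance

end Gorenstein

/-! ### Gorenstein modules are the images in totally acyclic complexes -/

section TotallyAcyclic

open ModuleCat

variable {R : Type u} [Ring R]

/-- Dimension shifting for a projective step. -/
lemma extVanishes_succ_of_exact {A P B Q : ModuleCat.{u} R} {i : A ⟶ P} {p : P ⟶ B}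
    (hP : Projective P) (hi : Function.Injective i) (hip : Function.Exact i p)
    (hp : Function.Surjective p) {k : ℕ} : ExtVanishes B Q (k + 1) ↔
      (∀ g : A ⟶ Q, ∃ h : P ⟶ Q, i ≫ h = g) ∧ ExtVanishes A Q k :=
  extVanishes_succ_iff (ModuleCat.shortExact_of_exact hi hip hp) Q k

namespace IsTotallyAcyclic

variable {P : ChainComplex (ModuleCat.{u} R) ℤ}

lemma function_exact (hP : IsTotallyAcyclic P) {i j k : ℤ} (hij : i = j + 1) (hjk : j = k + 1) :
    Function.Exact (P.d i j) (P.d j k) := by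
  have h := hP.acyclic j
  rw [P.exactAt_iff' i j k (by simp [hij]) (by simp [hjk])] at h
  exact (ShortComplex.ShortExact.moduleCat_exact_iff_function_exact _).1 h

lemma exists_extension (hP : IsTotallyAcyclic P) {i j : ℤ} (hij : i = j + 1)
    {Q : ModuleCat.{u} R} (hQ : Projective Q)
    (g : of R (LinearMap.range (P.d i j).hom) ⟶ Q) :
    ∃ h : P.X j ⟶ Q, ofHom (Submodule.subtype _) ≫ h = g := by
  obtain rfl : j = i - 1 := by omega
  let c : P.X i ⟶ of R (LinearMap.range (P.d i (i - 1)).hom) :=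
    ofHom (P.d i (i - 1)).hom.rangeRestrict
  have hc : c ≫ ofHom (Submodule.subtype _) = P.d i (i - 1) := rfl
  have hc' : P.d (i + 1) i ≫ c = 0 :=
    ModuleCat.hom_ext (LinearMap.ext fun x => Subtype.ext
      (ConcreteCategory.congr_hom (P.d_comp_d (i + 1) i (i - 1)) x))
  have hepi : Epi c := (ModuleCat.epi_iff_surjective c).2 (LinearMap.surjective_rangeRestrict _)
  obtain ⟨ψ, hψ⟩ := hP.hom_acyclic Q ((IsProjective.iff_projective _).2 hQ) i (c ≫ g)
    (by rw [← Category.assoc, hc', Limits.zero_comp])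
  refine ⟨ψ, ?_⟩
  rw [← cancel_epi c, ← Category.assoc, hc, hψ]

/-- The short exact sequences into which a totally acyclic complex decomposes. -/
lemma range_exact (hP : IsTotallyAcyclic P) {i j k : ℤ} (hij : i = j + 1) (hjk : j = k + 1) :
    Function.Exact (LinearMap.range (P.d i j).hom).subtype (P.d j k).hom.rangeRestrict := by
  refine LinearMap.exact_iff.2 ?_
  rw [LinearMap.ker_rangeRestrict, Submodule.range_subtype]
  exact LinearMap.exact_iff.1 (hP.function_exact hij hjk)

/-- Dimension shifting to the preceding image in the complex; the extension condition is acyclicity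
of `Hom(P, Q)`. -/
lemma extVanishes_range (hP : IsTotallyAcyclic P) {Q : ModuleCat.{u} R} (hQ : Projective Q)
    (n : ℕ) {i j : ℤ} (hij : i = j + 1) :
    ExtVanishes (of R (LinearMap.range (P.d i j).hom)) Q n := by
  induction n generalizing i j with
  | zero => exact extVanishes_zero _ _
  | succ n ih =>
    refine (extVanishes_succ_of_exact (A := of R (LinearMap.range (P.d (i + 1) i).hom))
      (P := P.X i) (i := ofHom (Submodule.subtype _)) (p := ofHom (P.d i j).hom.rangeRestrict)
      ((IsProjective.iff_projective _).1 (hP.projective i)) Subtype.val_injective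
      (hP.range_exact rfl hij) (LinearMap.surjective_rangeRestrict _)).2
      ⟨hP.exists_extension rfl hQ, ih rfl⟩

lemma isGorenstein (hP : IsTotallyAcyclic P) {M : ModuleCat.{u} R} {i j : ℤ} (hij : i = j + 1)
    (e : M ≃ₗ[R] LinearMap.range (P.d i j).hom) : IsGorenstein M := by
  refine ⟨fun M => ∃ i j : ℤ, i = j + 1 ∧ Nonempty (M ≃ₗ[R] LinearMap.range (P.d i j).hom), ?_,
    i, j, hij, ⟨e⟩⟩
  clear! M i j
  rintro M ⟨i, j, hij, ⟨e⟩⟩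
  refine ⟨fun Q k hQ => (hP.extVanishes_range hQ k hij).of_retract
    (LinearEquiv.toModuleIso e).retract, of R (LinearMap.range (P.d j (j - 1)).hom),
    ⟨j, j - 1, by ring, ⟨LinearEquiv.refl _ _⟩⟩, P.X j,
    ofHom (Submodule.subtype _ ∘ₗ e.toLinearMap), ofHom (P.d j (j - 1)).hom.rangeRestrict,
    (IsProjective.iff_projective _).1 (hP.projective j),
    Subtype.val_injective.comp e.injective, ?_, LinearMap.surjective_rangeRestrict _⟩
  refine LinearMap.exact_iff.2 ?_
  refine (LinearMap.exact_iff.1 (hP.range_exact hij (by ring))).trans ?_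
  exact (LinearMap.range_comp_of_range_eq_top _ (LinearMap.range_eq_top.2 e.surjective)).symm

end IsTotallyAcyclic

/-- A `ℤ`-indexed sequence of projective steps between modules without `Ext` into projectives
yields a totally acyclic complex. -/
lemma exists_totallyAcyclic_of_steps (M : ℤ → ModuleCat.{u} R)
    (hM : ∀ n, ExtProjVanishes (M n)) (hs : ∀ n, ProjectiveStep (M (n + 1)) (M n)) :
    ∃ P : ChainComplex (ModuleCat.{u} R) ℤ, IsTotallyAcyclic P ∧
      Nonempty (M 0 ≃ₗ[R] LinearMap.range (P.d 0 (-1)).hom) := by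
  -- `X n` lies between `M (n + 1)` and `M n`, so the differential out of `X (n + 1)` has image `M
  -- (n + 1)`. Thus `M 0` is the image of the differential from degree `0` to degree `-1`.
  choose X i p hX hi hip hp using hs
  let d : ∀ n, X (n + 1) ⟶ X n := fun n => p (n + 1) ≫ i n
  have hpi : ∀ n, i n ≫ p n = 0 := fun n =>
    ModuleCat.hom_ext (hip n).linearMap_comp_eq_zero
  let P := ChainComplex.of X d fun n => by
    simp only [d, Category.assoc]
    rw [← Category.assoc (i (n + 1)), hpi, Limits.zero_comp, Limits.comp_zero]
  have hd : ∀ n, P.d (n + 1) n = p (n + 1) ≫ i n := fun n => ChainComplex.of_d X d n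
  have hrange : ∀ n, LinearMap.range (P.d (n + 1) n).hom = LinearMap.range (i n).hom := fun n => by
    rw [hd, ModuleCat.hom_comp]
    exact LinearMap.range_comp_of_range_eq_top _ (LinearMap.range_eq_top.2 (hp (n + 1)))
  have hker : ∀ n, LinearMap.ker (P.d (n + 1) n).hom = LinearMap.ker (p (n + 1)).hom := fun n => by
    rw [hd, ModuleCat.hom_comp]
    exact LinearMap.ker_comp_of_ker_eq_bot _ (LinearMap.ker_eq_bot.2 (hi n))
  have hmain : ∀ a b : ℤ, a = b + 1 → Nonempty (M a ≃ₗ[R] LinearMap.range (P.d a b).hom) := by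
    rintro _ b rfl
    exact ⟨(LinearEquiv.ofInjective (i b).hom (hi b)).trans (LinearEquiv.ofEq _ _ (hrange b).symm)⟩
  refine ⟨P, ⟨fun n => (IsProjective.iff_projective _).2 (hX n), fun n => ?_, ?_⟩,
    hmain 0 (-1) (by norm_num)⟩
  · obtain ⟨n, rfl⟩ : ∃ m, n = m + 1 := ⟨n - 1, by ring⟩
    rw [P.exactAt_iff' (n + 1 + 1) (n + 1) n (by simp) (by simp)]
    refine (ShortComplex.ShortExact.moduleCat_exact_iff_function_exact _).2
      (LinearMap.exact_iff.2 ?_)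
    refine (hker n).trans (Eq.trans ?_ (hrange (n + 1)).symm)
    exact LinearMap.exact_iff.1 (hip (n + 1))
  · intro Q hQ n φ hφ
    have : ∀ b, n = b + 1 → ∃ ψ : P.X b ⟶ Q, P.d n b ≫ ψ = φ := by
      rintro b rfl
      have hepi : Epi (p (b + 1 + 1)) := (ModuleCat.epi_iff_surjective _).2 (hp _)
      have hφ' : i (b + 1) ≫ φ = 0 := by
        rw [← cancel_epi (p (b + 1 + 1)), ← Category.assoc, ← hd, hφ, Limits.comp_zero]
      have hS := ModuleCat.shortExact_of_exact (hi (b + 1)) (hip (b + 1)) (hp (b + 1))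
      have hepi' : Epi (p (b + 1)) := (ModuleCat.epi_iff_surjective _).2 (hp _)
      -- A cocycle `φ` factors through `M (b + 1)`, and the factor extends to `X b` because `Ext¹(M
      -- b, Q) = 0`.
      have : ∃ g : M (b + 1) ⟶ Q, p (b + 1) ≫ g = φ :=
        ⟨hS.exact.desc φ hφ', hS.exact.g_desc φ hφ'⟩
      obtain ⟨g, hg⟩ := this
      obtain ⟨ψ, hψ⟩ := (hM b Q 1 ((IsProjective.iff_projective _).1 hQ)).exists_extension
        (hi b) (hip b) (hp b) g
      exact ⟨ψ, by rw [hd, Category.assoc, hψ, hg]⟩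
    exact this (n - 1) (by ring)

lemma exists_step_left (B : ModuleCat.{u} R) (hB : ExtProjVanishes B) :
    ∃ A, ExtProjVanishes A ∧ ProjectiveStep A B := by
  let P := Projective.over B
  let p : P ⟶ B := Projective.π B
  have hp : Function.Surjective p := (ModuleCat.epi_iff_surjective p).1 inferInstance
  have hip : Function.Exact (ofHom (LinearMap.ker p.hom).subtype) p :=
    LinearMap.exact_iff.2 (Submodule.range_subtype _).symm
  refine ⟨of R (LinearMap.ker p.hom), fun Q k hQ => ?_, P, ofHom (Submodule.subtype _), p,
    inferInstance, Subtype.val_injective, hip, hp⟩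
  exact ((extVanishes_succ_of_exact (A := of R (LinearMap.ker p.hom))
    (i := ofHom (LinearMap.ker p.hom).subtype) (p := p)
    (inferInstanceAs (Projective (Projective.over B))) Subtype.val_injective hip hp).1
    (hB Q (k + 1) hQ)).2

lemma IsGorenstein.exists_totallyAcyclic {M : ModuleCat.{u} R} (hM : IsGorenstein M) :
    ∃ P : ChainComplex (ModuleCat.{u} R) ℤ, IsTotallyAcyclic P ∧
      Nonempty (M ≃ₗ[R] LinearMap.range (P.d 0 (-1)).hom) := by
  choose! up hup hups using fun (M : ModuleCat.{u} R) (hM : IsGorenstein M) =>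
    (isGorensteinClass_isGorenstein M hM).2
  choose! down hdown hdowns using exists_step_left (R := R)
  have hA : ∀ n, ExtProjVanishes (down^[n] M) := fun n => by
    induction n with
    | zero => exact (isGorensteinClass_isGorenstein M hM).1
    | succ n ih => rw [Function.iterate_succ_apply']; exact hdown _ ih
  have hB : ∀ n, IsGorenstein (up^[n] M) := fun n => by
    induction n with
    | zero => exact hM
    | succ n ih => rw [Function.iterate_succ_apply']; exact hup _ ih
  -- Syzygies fill the nonnegative degrees and iterated cokernels the negative ones. The steps split
  -- into those among syzygies, the junction from `0` to `-1`, and those among cokernels.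
  refine exists_totallyAcyclic_of_steps
    (fun n : ℤ => match n with
      | .ofNat n => down^[n] M
      | .negSucc n => up^[n + 1] M) ?_ ?_
  · rintro (n | n)
    · exact hA n
    · exact (isGorensteinClass_isGorenstein _ (hB (n + 1))).1
  · rintro (n | n | n)
    · change ProjectiveStep (down^[n + 1] M) (down^[n] M)
      rw [Function.iterate_succ_apply']
      exact hdowns _ (hA n)
    · exact hups _ hM
    · change ProjectiveStep (up^[n + 1] M) (up^[n + 1 + 1] M)
      rw [Function.iterate_succ_apply' up (n + 1)]
      exact hups _ (hB (n + 1))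

lemma gproj_iff (M : ModuleCat.{u} R) : Gproj R M ↔ Module.Finite R M ∧ IsGorenstein M := by
  refine and_congr_right fun _ => ⟨?_, IsGorenstein.exists_totallyAcyclic⟩
  rintro ⟨P, hP, ⟨e⟩⟩
  exact hP.isGorenstein (by norm_num) e

lemma Gproj.of_retract {M M' : ModuleCat.{u} R} (h : Gproj R M') (r : Retract M M') :
    Gproj R M := by
  rw [gproj_iff] at h ⊢
  have := h.1
  exact ⟨Module.Finite.of_surjective r.r.hom
    (fun x => ⟨r.i.hom x, ConcreteCategory.congr_hom r.retract x⟩), h.2.of_retract r⟩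

end TotallyAcyclic

/-! ### Transfer of Gorenstein projective modules -/

section GorensteinFrobenius

universe w

open ModuleCat

namespace FrobeniusSystem

variable {ι : Type w} [Fintype ι] {R S : Type u} [Ring R] [Ring S] {φ : R →+* S}

lemma gproj_restrict (E : FrobeniusSystem φ ι) {N : ModuleCat.{u} S} (h : Gproj S N) :
    Gproj R ((restrictScalars φ).obj N) := by
  rw [gproj_iff] at h ⊢
  have := h.1
  have := E.restrict_finite_limits
  have := restrict_finite_colimits φ
  have := E.restrict_projective
  have := E.coextend_projective
  exact ⟨E.restrict_module_finite N, h.2.map (restrictCoextendScalarsAdj φ)⟩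

lemma gproj_coextend (E : FrobeniusSystem φ ι) {M : ModuleCat.{u} R} (h : Gproj R M) :
    Gproj S ((coextendScalars φ).obj M) := by
  rw [gproj_iff] at h ⊢
  have := h.1
  have := coextend_finite_limits φ
  have := E.coextend_finite_colimits
  have := E.coextend_additive
  have := E.coextend_projective
  have := E.restrict_projective
  exact ⟨E.coextend_module_finite M, h.2.map E.coextendRestrictAdj⟩

end FrobeniusSystem

end GorensteinFrobenius

/-! ### Krull–Schmidt arguments and transfer of finite representation type -/

section FiniteLength

open ModuleCat Limits

universe w

variable {R : Type u} [Ring R]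

lemma CategoryTheory.Indecomposable.eq_bot_or_eq_bot {N : ModuleCat.{u} R} (hN : Indecomposable N)
    {p q : Submodule R N} (h : IsCompl p q) : p = ⊥ ∨ q = ⊥ := by
  have e : N ≅ of R p ⊞ of R q :=
    (LinearEquiv.toModuleIso (Submodule.prodEquivOfIsCompl p q h)).symm ≪≫
      (ModuleCat.biprodIsoProd (of R p) (of R q)).symm
  refine (hN.2 _ _ e).imp (fun h => ?_) (fun h => ?_)
  · exact Submodule.subsingleton_iff_eq_bot.1 (ModuleCat.subsingleton_of_isZero h)
  · exact Submodule.subsingleton_iff_eq_bot.1 (ModuleCat.subsingleton_of_isZero h)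

/-- Indecomposable modules of finite length have local endomorphism rings. -/
lemma CategoryTheory.Indecomposable.isLocalRing_end {N : ModuleCat.{u} R} [IsNoetherian R N]
    [IsArtinian R N] (hN : Indecomposable N) : IsLocalRing (Module.End R N) := by
  have : Nontrivial N := by
    by_contra h
    rw [not_nontrivial_iff_subsingleton] at h
    exact hN.1 (ModuleCat.isZero_of_subsingleton N)
  refine IsLocalRing.of_isUnit_or_isUnit_one_sub_self fun a => ?_
  -- Fitting's lemma: kernel and range of a high power are complementary, so one is zero. The
  -- exponent `n + 1` is used because it is nonzero.
  obtain ⟨n, hn⟩ := Filter.eventually_atTop.1 (LinearMap.eventually_isCompl_ker_pow_range_pow a)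
  have hc := hn (n + 1) n.le_succ
  rcases hN.eq_bot_or_eq_bot hc with h | h
  · left
    rw [← isUnit_pow_iff n.succ_ne_zero, Module.End.isUnit_iff]
    refine ⟨LinearMap.ker_eq_bot.1 h, LinearMap.range_eq_top.1 ?_⟩
    rw [h] at hc
    exact eq_top_of_bot_isCompl hc
  · right
    exact IsNilpotent.isUnit_one_sub ⟨n + 1, LinearMap.range_eq_bot.1 h⟩

/-- An indecomposable retract of an object which decomposes is a retract of one of the pieces. -/
lemma CategoryTheory.Indecomposable.exists_retract {N X : ModuleCat.{u} R} [IsNoetherian R N]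
    [IsArtinian R N] (hN : Indecomposable N) (r : Retract N X) {ι : Type*} [Fintype ι] {Y : ι → ModuleCat.{u} R}
    (a : ∀ l, X ⟶ Y l) (b : ∀ l, Y l ⟶ X) (h : ∑ l, a l ≫ b l = 𝟙 X) :
    ∃ l, Nonempty (Retract N (Y l)) := by
  have := hN.isLocalRing_end
  have hsum : ∑ l, (r.i ≫ a l ≫ b l ≫ r.r).hom = (1 : Module.End R N) := by
    rw [← ModuleCat.hom_sum]
    have : ∑ l, r.i ≫ a l ≫ b l ≫ r.r = 𝟙 N := by
      simp_rw [← Category.assoc (a _)]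
      rw [← Preadditive.comp_sum, ← Preadditive.sum_comp, h, Category.id_comp, r.retract]
    rw [this]
    rfl
  -- In a local ring some term of a sum equal to `1` is a unit; its inverse corrects the maps
  -- through `Y l` to a retract.
  obtain ⟨l, -, hl⟩ := IsLocalRing.exists_of_isUnit_sum (hsum ▸ isUnit_one)
  have hiso : IsIso (r.i ≫ a l ≫ b l ≫ r.r) :=
    (ConcreteCategory.isIso_iff_bijective _).2 ((Module.End.isUnit_iff _).1 hl)
  refine ⟨l, ⟨⟨r.i ≫ a l, b l ≫ r.r ≫ inv (r.i ≫ a l ≫ b l ≫ r.r), ?_⟩⟩⟩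
  have := IsIso.hom_inv_id (r.i ≫ a l ≫ b l ≫ r.r)
  simpa only [Category.assoc] using this

/-- A retract splits `Y` as image plus kernel; the image is nonzero, so the kernel vanishes. -/
lemma CategoryTheory.Indecomposable.nonempty_iso_of_retract {N Y : ModuleCat.{u} R}
    (hN : Indecomposable N) (hY : Indecomposable Y) (r : Retract N Y) : Nonempty (N ≅ Y) := by
  have hr : ∀ x, r.r (r.i x) = x := fun x => ConcreteCategory.congr_hom r.retract x
  have hc : IsCompl (LinearMap.range r.i.hom) (LinearMap.ker r.r.hom) := by
    refine ⟨Submodule.disjoint_def.2 ?_, codisjoint_iff.2 (eq_top_iff.2 fun y _ => ?_)⟩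
    · rintro _ ⟨x, rfl⟩ hx
      have : x = 0 := (hr x).symm.trans hx
      rw [this, map_zero]
    · refine Submodule.mem_sup.2 ⟨r.i (r.r y), ⟨_, rfl⟩, y - r.i (r.r y), ?_, by abel⟩
      rw [LinearMap.mem_ker, map_sub]
      exact sub_eq_zero.2 (hr (r.r y)).symm
  rcases hY.eq_bot_or_eq_bot hc with h | h
  · refine (hN.1 ?_).elim
    have : Subsingleton N := subsingleton_of_forall_eq 0 fun x => by
      have hx : r.i.hom x = 0 := LinearMap.congr_fun (LinearMap.range_eq_bot.1 h) x
      exact (hr x).symm.trans ((congrArg r.r hx).trans (map_zero r.r.hom))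
    exact ModuleCat.isZero_of_subsingleton N
  · exact ⟨(LinearEquiv.toModuleIso (LinearEquiv.ofBijective r.r.hom
      ⟨LinearMap.ker_eq_bot.1 h, fun x => ⟨_, hr x⟩⟩)).symm⟩

/-- Modules of finite length decompose into finitely many indecomposables. -/
lemma exists_indecomposable_decomposition (X : ModuleCat.{u} R) [IsNoetherian R X]
    [IsArtinian R X] : ∃ (ι : Type) (_ : Fintype ι) (Y : ι → ModuleCat.{u} R)
      (r : ∀ l, Retract (Y l) X), (∀ l, Indecomposable (Y l)) ∧
        ∑ l, (r l).r ≫ (r l).i = 𝟙 X := by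
  -- Induction on a bound for the length: in a proper decomposition each piece has length at least
  -- one, which lowers the bound for the other.
  obtain ⟨n, hn⟩ : ∃ n : ℕ, Module.length R X ≤ n :=
    ⟨_, (ENat.natCast_toNat Module.length_ne_top).ge⟩
  induction n generalizing X with
  | zero =>
    have : Subsingleton X := Module.length_eq_zero_iff.1 (le_antisymm hn bot_le)
    exact ⟨Empty, inferInstance, fun l => l.elim, fun l => l.elim, fun l => l.elim,
      (ModuleCat.isZero_of_subsingleton X).eq_of_src _ _⟩
  | succ n ih =>
    by_cases h0 : IsZero X
    · exact ⟨Empty, inferInstance, fun l => l.elim, fun l => l.elim, fun l => l.elim,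
        h0.eq_of_src _ _⟩
    by_cases hX : Indecomposable X
    · exact ⟨Unit, inferInstance, fun _ => X, fun _ => Retract.refl X, fun _ => hX, by simp⟩
    obtain ⟨Y, Z, e, hY, hZ⟩ : ∃ (Y Z : ModuleCat.{u} R) (_ : X ≅ Y ⊞ Z),
        ¬ IsZero Y ∧ ¬ IsZero Z := by
      by_contra! h
      exact hX ⟨h0, fun Y Z e => or_iff_not_imp_left.2 (h Y Z e)⟩
    let e' : X ≃ₗ[R] (Y × Z) := (e ≪≫ ModuleCat.biprodIsoProd Y Z).toLinearEquiv
    have hYs : Function.Surjective (LinearMap.fst R Y Z ∘ₗ e'.toLinearMap) :=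
      Prod.fst_surjective.comp e'.surjective
    have hZs : Function.Surjective (LinearMap.snd R Y Z ∘ₗ e'.toLinearMap) :=
      Prod.snd_surjective.comp e'.surjective
    have := isNoetherian_of_surjective _ (LinearMap.range_eq_top.2 hYs)
    have := isNoetherian_of_surjective _ (LinearMap.range_eq_top.2 hZs)
    have := isArtinian_of_surjective _ _ hYs
    have := isArtinian_of_surjective _ _ hZs
    have hlen : Module.length R Y + Module.length R Z ≤ (n + 1 : ℕ) := by
      rw [← Module.length_prod, ← e'.length_eq]
      exact hn
    have hpos : ∀ W : ModuleCat.{u} R, ¬ IsZero W → 1 ≤ Module.length R W := fun W hW => by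
      rw [Order.one_le_iff_pos, Module.length_pos_iff]
      by_contra h
      rw [not_nontrivial_iff_subsingleton] at h
      exact hW (ModuleCat.isZero_of_subsingleton W)
    have hY₁ := hpos Y hY
    have hZ₁ := hpos Z hZ
    obtain ⟨ι₁, _, Y₁, r₁, h₁, hs₁⟩ := ih Y (by
      refine (ENat.add_le_add_iff_right (ENat.natCast_ne_top 1)).1 ?_
      exact (add_le_add_right hZ₁ _).trans hlen)
    obtain ⟨ι₂, _, Y₂, r₂, h₂, hs₂⟩ := ih Z (by
      refine (ENat.add_le_add_iff_left (ENat.natCast_ne_top 1)).1 ?_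
      exact (add_le_add_left hY₁ _).trans (hlen.trans (by rw [add_comm]; rfl)))
    refine ⟨ι₁ ⊕ ι₂, inferInstance, Sum.elim Y₁ Y₂, fun l => match l with
      | .inl l => ⟨(r₁ l).i ≫ biprod.inl ≫ e.inv, e.hom ≫ biprod.fst ≫ (r₁ l).r, by simp⟩
      | .inr l => ⟨(r₂ l).i ≫ biprod.inr ≫ e.inv, e.hom ≫ biprod.snd ≫ (r₂ l).r, by simp⟩, ?_, ?_⟩
    · rintro (l | l)
      · exact h₁ l
      · exact h₂ l
    · have e₁ : ∑ l, (e.hom ≫ biprod.fst ≫ (r₁ l).r) ≫ (r₁ l).i ≫ biprod.inl ≫ e.inv =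
          e.hom ≫ (biprod.fst ≫ biprod.inl) ≫ e.inv := by
        trans e.hom ≫ (biprod.fst ≫ (∑ l, (r₁ l).r ≫ (r₁ l).i) ≫ biprod.inl) ≫ e.inv
        · simp only [Preadditive.comp_sum, Preadditive.sum_comp, Category.assoc]
        · rw [hs₁, Category.id_comp]
      have e₂ : ∑ l, (e.hom ≫ biprod.snd ≫ (r₂ l).r) ≫ (r₂ l).i ≫ biprod.inr ≫ e.inv =
          e.hom ≫ (biprod.snd ≫ biprod.inr) ≫ e.inv := by
        trans e.hom ≫ (biprod.snd ≫ (∑ l, (r₂ l).r ≫ (r₂ l).i) ≫ biprod.inr) ≫ e.inv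
        · simp only [Preadditive.comp_sum, Preadditive.sum_comp, Category.assoc]
        · rw [hs₂, Category.id_comp]
      rw [Fintype.sum_sum_type]
      refine (congrArg₂ (· + ·) e₁ e₂).trans ?_
      rw [← Preadditive.comp_add, ← Preadditive.add_comp, biprod.total, Category.id_comp,
        e.hom_inv_id]

/-- A module of finite length has only finitely many indecomposable retracts up to isomorphism. -/
lemma finite_indecomposable_retracts [IsArtinianRing R] (X : ModuleCat.{u} R)
    [Module.Finite R X] :
    {c : Quotient (isIsomorphicSetoid (ModuleCat.{u} R)) | ∃ N : ModuleCat.{u} R,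
      Module.Finite R N ∧ Indecomposable N ∧ Nonempty (Retract N X) ∧
        Quotient.mk _ N = c}.Finite := by
  obtain ⟨ι, _, Y, r, hY, hs⟩ := exists_indecomposable_decomposition X
  refine (Set.finite_range fun l => Quotient.mk (isIsomorphicSetoid (ModuleCat.{u} R))
    (Y l)).subset ?_
  rintro _ ⟨N, hN, hNi, ⟨rN⟩, rfl⟩
  obtain ⟨l, ⟨rl⟩⟩ := hNi.exists_retract rN (fun l => (r l).r) (fun l => (r l).i) hs
  obtain ⟨e⟩ := hNi.nonempty_iso_of_retract (hY l) rl
  exact ⟨l, Quotient.sound ⟨e.symm⟩⟩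

/-- Transfer of finite representation type along a pair of functors. -/
lemma HasFiniteRepType.of_functors {S : Type u} [Ring S] [IsArtinianRing R] [IsArtinianRing S]
    {𝒳 : ObjectProperty (ModuleCat.{u} R)} {𝒴 : ObjectProperty (ModuleCat.{u} S)}
    (h𝒳 : ∀ M, 𝒳 M → Module.Finite R M) (h𝒴 : ∀ N, 𝒴 N → Module.Finite S N)
    (hr : ∀ M M', 𝒳 M' → Retract M M' → 𝒳 M)
    (K : ModuleCat.{u} R ⥤ ModuleCat.{u} S) [K.Additive]
    (hK : ∀ M : ModuleCat.{u} R, Module.Finite R M → Module.Finite S (K.obj M))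
    (J : ModuleCat.{u} S ⥤ ModuleCat.{u} R) (hJ : ∀ N, 𝒴 N → 𝒳 (J.obj N))
    (hKJ : ∀ N, Nonempty (Retract N (K.obj (J.obj N)))) (h : HasFiniteRepType 𝒳) :
    HasFiniteRepType 𝒴 := by
  refine (Set.Finite.biUnion h (t := fun c => {d | ∃ N : ModuleCat.{u} S,
      Module.Finite S N ∧ Indecomposable N ∧ Nonempty (Retract N (K.obj c.out)) ∧
        Quotient.mk _ N = d}) ?_).subset ?_
  · rintro c ⟨M, hM, -, rfl⟩
    obtain ⟨e⟩ : Nonempty ((Quotient.mk (isIsomorphicSetoid (ModuleCat.{u} R)) M).out ≅ M) :=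
      Quotient.mk_out (s := isIsomorphicSetoid (ModuleCat.{u} R)) M
    have := h𝒳 _ (hr _ _ hM e.retract)
    have := hK _ this
    exact finite_indecomposable_retracts _
  · rintro _ ⟨N, hN, hNi, rfl⟩
    have := h𝒴 N hN
    have := h𝒳 _ (hJ N hN)
    obtain ⟨rN⟩ := hKJ N
    obtain ⟨ι, _, Y, r, hY, hs⟩ := exists_indecomposable_decomposition (J.obj N)
    -- `N` is a retract of `K (J N)`, which `K` decomposes along the indecomposable summands of `J
    -- N`; locality places `N` in one `K (Y l)`.
    obtain ⟨l, ⟨rl⟩⟩ := hNi.exists_retract rN (fun l => K.map (r l).r) (fun l => K.map (r l).i) (by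
      simp_rw [← K.map_comp]
      rw [← K.map_sum, hs, K.map_id])
    obtain ⟨e⟩ : Nonempty ((Quotient.mk (isIsomorphicSetoid (ModuleCat.{u} R)) (Y l)).out ≅ Y l) :=
      Quotient.mk_out (s := isIsomorphicSetoid (ModuleCat.{u} R)) (Y l)
    refine Set.mem_biUnion (x := Quotient.mk _ (Y l)) ⟨Y l, hr _ _ (hJ N hN) (r l), hY l, rfl⟩
      ⟨N, h𝒴 N hN, hNi, ⟨rl.trans (K.mapIso e.symm).retract⟩, rfl⟩

end FiniteLength

/-! ### The skew group ring as a Frobenius extension -/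

section SkewGroupRing

universe u₁ u₂

open SkewMonoidAlgebra

/-- The inclusion of the base ring into the skew group ring. -/
noncomputable def skewInclusion (Λ : Type u₁) [Ring Λ] (G : Type u₂) [Group G]
    [MulSemiringAction G Λ] : Λ →+* SkewMonoidAlgebra Λ G where
  toFun := single 1
  map_one' := rfl
  map_mul' a b := by simp [single_mul_single]
  map_zero' := single_zero 1
  map_add' := single_add 1

/-- A skew group ring of a finite group is a Frobenius extension of the base ring. -/
noncomputable def skewFrobeniusSystem (Λ : Type u₁) [Ring Λ] (G : Type u₂) [Group G] [Fintype G]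
    [MulSemiringAction G Λ] : FrobeniusSystem (skewInclusion Λ G) G where
  trace :=
    { toFun := fun s => s.coeff 1
      map_zero' := by simp
      map_add' := fun s t => by simp }
  trace_left r s := by
    classical
    induction s using SkewMonoidAlgebra.induction_on with
    | zero => simp
    | single g b =>
      by_cases h : g = 1
      · subst h
        simp [skewInclusion, single_mul_single]
      · simp [skewInclusion, single_mul_single, h]
    | add f g hf hg =>
      change (_ * (f + g)).coeff 1 = r * (f + g).coeff 1
      rw [mul_add, coeff_add, Finsupp.add_apply, coeff_add, Finsupp.add_apply, mul_add]
      exact congrArg₂ (· + ·) hf hg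
  trace_right s r := by
    classical
    induction s using SkewMonoidAlgebra.induction_on with
    | zero => simp
    | single g b =>
      by_cases h : g = 1
      · subst h
        simp [skewInclusion, single_mul_single]
      · simp [skewInclusion, single_mul_single, h]
    | add f g hf hg =>
      change ((f + g) * _).coeff 1 = (f + g).coeff 1 * r
      rw [add_mul, coeff_add, Finsupp.add_apply, coeff_add, Finsupp.add_apply, add_mul]
      exact congrArg₂ (· + ·) hf hg
  x g := single g⁻¹ 1
  y g := single g 1
  sum_left s := by
    classical
    induction s using SkewMonoidAlgebra.induction_on with
    | zero => simp
    | single h b =>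
      rw [Finset.sum_eq_single h]
      · simp [skewInclusion, single_mul_single]
      · intro g _ hg
        simp [skewInclusion, single_mul_single, mul_inv_eq_one, hg.symm]
      · simp
    | add f g hf hg =>
      conv_rhs => rw [← hf, ← hg, ← Finset.sum_add_distrib]
      refine Finset.sum_congr rfl fun i _ => ?_
      rw [add_mul, map_add, map_add, add_mul]
  sum_right s := by
    classical
    induction s using SkewMonoidAlgebra.induction_on with
    | zero => simp
    | single h b =>
      -- The product `g * (b h) = g(b) gh` has a coefficient at `1` only for `g = h⁻¹`; moving
      -- `g(b)` back past `g⁻¹` undoes the twist and returns `b h`.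
      rw [Finset.sum_eq_single h⁻¹]
      · simp [skewInclusion, single_mul_single]
      · intro g _ hg
        simp [skewInclusion, single_mul_single, mul_eq_one_iff_eq_inv, hg]
      · simp
    | add f g hf hg =>
      conv_rhs => rw [← hf, ← hg, ← Finset.sum_add_distrib]
      refine Finset.sum_congr rfl fun i _ => ?_
      rw [mul_add, map_add, map_add, mul_add]

lemma skewFrobeniusSystem_trace_one (Λ : Type u₁) [Ring Λ] (G : Type u₂) [Group G] [Fintype G]
    [MulSemiringAction G Λ] : (skewFrobeniusSystem Λ G).trace 1 = 1 :=
  (DFunLike.congr_fun coeff_one 1).trans Finsupp.single_eq_same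

/-- Every term is `g⁻¹ g = 1`. This is the element whose invertibility splits the counit. -/
lemma skewFrobeniusSystem_sum (Λ : Type u₁) [Ring Λ] (G : Type u₂) [Group G] [Fintype G]
    [MulSemiringAction G Λ] :
    ∑ g, (skewFrobeniusSystem Λ G).x g * (skewFrobeniusSystem Λ G).y g = (Nat.card G : ℕ) := by
  have h : ∀ g, (skewFrobeniusSystem Λ G).x g * (skewFrobeniusSystem Λ G).y g = 1 := fun g => by
    change single g⁻¹ 1 * single g 1 = (1 : SkewMonoidAlgebra Λ G)
    simp [single_mul_single]
  simp [h]

end SkewGroupRing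

/-! ### Transfer along split separable Frobenius extensions, and the corollary -/

section FrobeniusTransfer

open ModuleCat

universe w

namespace FrobeniusSystem

variable {ι : Type w} [Fintype ι] {R S : Type u} [Ring R] [Ring S] {φ : R →+* S}

/-- `S` is finitely generated over `R`, and left ideals of `S` are `R`-submodules. -/
lemma isArtinianRing (E : FrobeniusSystem φ ι) [IsArtinianRing R] : IsArtinianRing S := by
  have : Module.Finite R ((restrictScalars φ).obj (of S S)) :=
    E.restrict_module_finite (of S S)
  let : Module R S := Module.compHom S φ
  have : IsScalarTower R S S := ⟨fun r s n => mul_assoc (φ r) s n⟩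
  have : Module.Finite R S := ‹Module.Finite R ((restrictScalars φ).obj (of S S))›
  have : IsArtinian R S := inferInstance
  exact isArtinian_of_tower R this

/-- For a split separable Frobenius extension of Artinian rings, classes of finitely generated
modules that correspond to each other under restriction and coextension have finite
representation type simultaneously. -/
lemma hasFiniteRepType_iff (E : FrobeniusSystem φ ι) [IsArtinianRing R] [IsArtinianRing S]
    (htr : E.trace 1 = 1) {n : ℕ} (hsum : ∑ i, E.x i * E.y i = n) (hn : IsUnit (n : S))
    {𝒳 : ObjectProperty (ModuleCat.{u} R)} {𝒴 : ObjectProperty (ModuleCat.{u} S)}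
    (h𝒳 : ∀ M, 𝒳 M → Module.Finite R M) (h𝒴 : ∀ N, 𝒴 N → Module.Finite S N)
    (hr𝒳 : ∀ M M', 𝒳 M' → Retract M M' → 𝒳 M) (hr𝒴 : ∀ N N', 𝒴 N' → Retract N N' → 𝒴 N)
    (hF : ∀ M, 𝒳 M → 𝒴 ((coextendScalars φ).obj M))
    (hU : ∀ N, 𝒴 N → 𝒳 ((restrictScalars φ).obj N)) :
    HasFiniteRepType 𝒴 ↔ HasFiniteRepType 𝒳 := by
  have := E.coextend_additive
  exact ⟨HasFiniteRepType.of_functors h𝒴 h𝒳 hr𝒴 (restrictScalars φ)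
      (fun N _ => E.restrict_module_finite N) (coextendScalars φ) hF
      fun M => ⟨E.retractRestrictCoextend htr M⟩,
    HasFiniteRepType.of_functors h𝒳 h𝒴 hr𝒳 (coextendScalars φ)
      (fun M _ => E.coextend_module_finite M) (restrictScalars φ) hU
      (E.nonempty_retract_coextend_restrict hsum hn)⟩

end FrobeniusSystem

end FrobeniusTransfer

theorem corollary6p9 (Λ : Type (max u v)) [Ring Λ] [IsArtinianRing Λ]
    (G : Type v) [Group G] [Finite G] [MulSemiringAction G Λ]
    (hG : IsUnit (Nat.card G : Λ)) :
    (∀ k : ℕ, 0 < k →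
      (HasFiniteRepType (TF (SkewMonoidAlgebra Λ G) k) ↔ HasFiniteRepType (TF Λ k))) ∧
    (IsCMFinite (SkewMonoidAlgebra Λ G) ↔ IsCMFinite Λ) := by
  have := Fintype.ofFinite G
  let E := skewFrobeniusSystem Λ G
  have := E.isArtinianRing
  have hn : IsUnit ((Nat.card G : ℕ) : SkewMonoidAlgebra Λ G) := by
    simpa using hG.map (skewInclusion Λ G)
  have htr := skewFrobeniusSystem_trace_one Λ G
  have hsum := skewFrobeniusSystem_sum Λ G
  refine ⟨fun k _ => ?_, ?_⟩
  · exact E.hasFiniteRepType_iff htr hsum hn (fun _ h => h.1) (fun _ h => h.1)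
      (fun _ _ => TF.of_retract) (fun _ _ => TF.of_retract) (fun _ => E.TF_coextend)
      (fun _ => E.TF_restrict)
  · exact E.hasFiniteRepType_iff htr hsum hn (fun _ h => h.1) (fun _ h => h.1)
      (fun _ _ => Gproj.of_retract) (fun _ _ => Gproj.of_retract) (fun _ => E.gproj_coextend)
      (fun _ => E.gproj_restrict)
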